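/- **Setting.** Let $\mathcal H$ be a separable real reproducing kernel Hilbert space of functions on an outcome space $\mathcal Y$, with kernel $K$ and measurable feature map $\phi(y)=K(y,\cdot)$, $\|\phi(y)\|_{\mathcal H}\le R_2$. Let $\mathcal X$ be a feature space, $\mathcal A$ a finite nonempty action set, $\mathcal D$ a probability distribution on $\mathcal X\times\mathcal Y$, $R_1,R_2,\beta,\epsilon>0$ and $\delta\in(0,1)$. Let $\mathcal L_{\mathcal H}=\{\ell:\ r_\ell(a):=\ell(a,\cdot)\in\mathcal H,\ \|r_\ell(a)\|_{\mathcal H}\le R_1\ \forall a\in\mathcal A\}$. A predictor $p:\mathcal X\to\mathcal H$ induces the loss estimator $f_p(x,a,\ell)=\langle r_\ell(a),p(x)\rangle$ and the smooth decision rules $\tilde k_{f_p,\ell}(x,a)=e^{-\beta f_p(x,a,\ell)}/\sum_{a'}e^{-\beta f_p(x,a',\ell)}$; let $\tilde{\mathcal K}_{\mathcal L_{\mathcal H}}=\{\tilde k_{f_p,\ell}:\ell\in\mathcal L_{\mathcal H}\}$. The estimator $f_p$ is $(\mathcal L_{\mathcal H},\tilde{\mathcal K}_{\mathcal L_{\mathcal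 H}},\epsilon)$-decision calibrated if $$\sup_{\ell\in\mathcal L_{\mathcal H},\,k\in\tilde{\mathcal K}_{\mathcal L_{\mathcal H}}}\Bigl|\mathbb E_{\mathcal D}\sum_a k(x,a)\,\ell(a,y)-\mathbb E_{\mathcal D}\sum_a k(x,a)\,f_p(x,a,\ell)\Bigr|\le\epsilon .$$ **Algorithm.** Start from a measurable $p_0:\mathcal X\to\mathcal H$ with $\|p_0(x)\|\le R_2$ for all $x$. In round $t=0,1,\dots$: if no pair $\ell,\ell'\in\mathcal L_{\mathcal H}$ satisfies $$\mathbb E_{\mathcal D}\Bigl\langle \sum_a r_{\ell}(a)\,\tilde k_{f_{p_t},\ell'}(x,a),\ \phi(y)-p_t(x)\Bigr\rangle>\epsilon ,$$ stop and output $p_t$. Otherwise an auditing oracle supplies such a pair $(\ell_t,\ell'_t)$, in any way that depends measurably on the samples of the earlier rounds. Draw a fresh batch of i.i.d. samples from $\mathcal D$ and, with $\hat{\mathbb E}$ the mean over this batch and $\tilde k(x)=(\tilde k_{f_{p_t},\ell'_t}(x,a))_{a\in\mathcal A}$, compute $\hat D_{aa'}=\hat{\mathbb E}[\tilde k(x)_a\tilde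 k(x)_{a'}]$ and $\hat G_a=\hat{\mathbb E}[(\phi(y)-p_t(x))\,\tilde k(x)_a]\in\mathcal H$. Set $$p_{t+1}(x)=\pi_{B(R_2)}\bigl(p_t(x)+\hat G^{T}(\hat D+I)^{-1}\tilde k(x)\bigr),$$ where $\pi_{B(R_2)}$ is the projection onto the closed ball of radius $R_2$ in $\mathcal H$. **Theorem.** There are absolute constants $C_1,C_2>0$ such that in this setting the following holds. Let $$T=\Bigl\lfloor C_1\,\frac{|\mathcal A|\,R_1^2R_2^2}{\epsilon^2}\Bigr\rfloor,\qquad N\ \ge\ C_2\,\frac{|\mathcal A|^6R_1^6R_2^6}{\epsilon^6}\,\log\Bigl(2+\frac{|\mathcal A|R_1R_2}{\epsilon\,\delta}\Bigr),$$ and suppose that the algorithm is run on $N$ i.i.d. samples, using batches of $\lfloor N/T\rfloor$ samples. Then with probability at least $1-\delta$ the algorithm stops after at most $T$ iterations, and its output $p$ is such that $f_{p}$ is $(\mathcal L_{\mathcal H},\tilde{\mathcal K}_{\mathcal L_{\mathcal H}},\epsilon)$-decision calibrated and $$\mathbb E\|p(x)-\phi(y)\|_{\mathcal H}^2\le\mathbb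 E\|p_0(x)-\phi(y)\|_{\mathcal H}^2 .$$ Moreover, if $p_0$ has the form $p_0(x)=\sum_{i=1}^m\alpha_i(x)\phi(y_i)$ with finitely many $y_i\in\mathcal Y$ and functions $\alpha_i:\mathcal X\to\mathbb R$, then so does $p$. In particular, for fixed $|\mathcal A|,R_1,R_2$, the number of iterations is $O(R_1^2R_2^2/\epsilon^2)$ and $\tilde O(1/\epsilon^6)$ samples suffice. -/

import Mathlib

open MeasureTheory
open scoped ENNReal

noncomputable section

namespace DecCal

/-! Throughout, `X` is the feature space, `Y` the outcome space, `A` the finite action space and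
`H` a real reproducing kernel Hilbert space of functions on `Y` (Mathlib's `RKHS ℝ H Y ℝ`).
A loss function all of whose sections `ℓ(a, ·)` lie in `H` is an element of `A → H`;
its value at `(a, y)` is `ℓ a y`, and its coefficient vector `r_ℓ(a)` is `ℓ a`. -/

/-- The feature map `φ(y) = K(y, ·)` of the kernel of `H`. -/
def feature {Y : Type*} (H : Type*) [NormedAddCommGroup H] [InnerProductSpace ℝ H]
    [CompleteSpace H] [RKHS ℝ H Y ℝ] (y : Y) : H :=
  RKHS.kerFun H y (1 : ℝ)

/-- The loss class `L_H`: all `ℓ` with `‖ℓ(a, ·)‖ ≤ R₁` for every action `a`. -/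
def lossClass (A H : Type*) [NormedAddCommGroup H] (R₁ : ℝ) : Set (A → H) :=
  {ℓ | ∀ a, ‖ℓ a‖ ≤ R₁}

/-- The loss estimator `f_p(x, a, ℓ) = ⟨r_ℓ(a), p(x)⟩` induced by a predictor `p`. -/
def lossEstimator {X A H : Type*} [NormedAddCommGroup H] [InnerProductSpace ℝ H]
    (p : X → H) (x : X) (a : A) (ℓ : A → H) : ℝ :=
  inner ℝ (ℓ a) (p x)

/-- The smooth optimal decision rule (quantal response) at parameter `β`. -/
def smoothRule {X A L : Type*} [Fintype A] (β : ℝ) (f : X → A → L → ℝ) (ℓ : L)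
    (x : X) (a : A) : ℝ :=
  Real.exp (-β * f x a ℓ) / ∑ a', Real.exp (-β * f x a' ℓ)

/-- The class of smooth optimal decision rules induced by the losses of a class `L`. -/
def smoothRules {X A L : Type*} [Fintype A] (β : ℝ) (f : X → A → L → ℝ) (𝓛 : Set L) :
    Set (X → A → ℝ) :=
  {k | ∃ ℓ ∈ 𝓛, k = smoothRule β f ℓ}

/-- The decision calibration error of a loss estimator `f`: the supremum over losses `ℓ ∈ 𝓛` and
decision rules `k ∈ 𝓚` of `|E E_{a ∼ k(x)} ℓ(a, y) - E E_{a ∼ k(x)} f(x, a, ℓ)|`. -/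
def decCalError {X Y A H : Type*} [MeasurableSpace X] [MeasurableSpace Y] [Fintype A]
    [NormedAddCommGroup H] [InnerProductSpace ℝ H] [RKHS ℝ H Y ℝ]
    (D : Measure (X × Y)) (𝓛 : Set (A → H)) (𝓚 : Set (X → A → ℝ))
    (f : X → A → (A → H) → ℝ) : ℝ≥0∞ :=
  ⨆ ℓ ∈ 𝓛, ⨆ k ∈ 𝓚, ENNReal.ofReal
    |(∫ z, ∑ a, k z.1 a * (ℓ a) z.2 ∂D) - ∫ z, ∑ a, k z.1 a * f z.1 a ℓ ∂D|

/-- `(𝓛, 𝓚, ε)`-decision calibration. -/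
def IsDecCalibrated {X Y A H : Type*} [MeasurableSpace X] [MeasurableSpace Y] [Fintype A]
    [NormedAddCommGroup H] [InnerProductSpace ℝ H] [RKHS ℝ H Y ℝ]
    (D : Measure (X × Y)) (𝓛 : Set (A → H)) (𝓚 : Set (X → A → ℝ)) (ε : ℝ)
    (f : X → A → (A → H) → ℝ) : Prop :=
  decCalError D 𝓛 𝓚 f ≤ ENNReal.ofReal ε

/-- The squared error `E ‖p(x) - φ(y)‖²`. -/
def sqError {X Y H : Type*} [MeasurableSpace X] [MeasurableSpace Y]
    [NormedAddCommGroup H] [InnerProductSpace ℝ H] [CompleteSpace H] [RKHS ℝ H Y ℝ]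
    (D : Measure (X × Y)) (p : X → H) : ℝ :=
  ∫ z, ‖p z.1 - feature H z.2‖ ^ 2 ∂D

/-- Predictors of the form `p(x) = ∑ i, αᵢ(x) φ(yᵢ)` with finitely many outcomes `yᵢ`. -/
def IsKernelExpansion {X Y H : Type*}
    [NormedAddCommGroup H] [InnerProductSpace ℝ H] [CompleteSpace H] [RKHS ℝ H Y ℝ]
    (p : X → H) : Prop :=
  ∃ (m : ℕ) (α : Fin m → X → ℝ) (y : Fin m → Y), ∀ x, p x = ∑ i, α i x • feature H (y i)

/-! ### The algorithm -/

/-- The quantity `E ⟨∑ₐ r_ℓ(a) k̃_{ℓ'}(x, a), φ(y) - p(x)⟩` that is tested by the loop. -/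
def gap {X Y A H : Type*} [MeasurableSpace X] [MeasurableSpace Y] [Fintype A]
    [NormedAddCommGroup H] [InnerProductSpace ℝ H] [CompleteSpace H] [RKHS ℝ H Y ℝ]
    (D : Measure (X × Y)) (β : ℝ) (p : X → H) (ℓ ℓ' : A → H) : ℝ :=
  ∫ z, inner ℝ (∑ a, smoothRule β (lossEstimator p) ℓ' z.1 a • ℓ a)
    (feature H z.2 - p z.1) ∂D

/-- `(ℓ, ℓ')` is a pair of losses of the class that violates decision calibration of `p`. -/
def IsViolation {X Y A H : Type*} [MeasurableSpace X] [MeasurableSpace Y] [Fintype A]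
    [NormedAddCommGroup H] [InnerProductSpace ℝ H] [CompleteSpace H] [RKHS ℝ H Y ℝ]
    (D : Measure (X × Y)) (β R₁ ε : ℝ) (p : X → H) (q : (A → H) × (A → H)) : Prop :=
  q.1 ∈ lossClass A H R₁ ∧ q.2 ∈ lossClass A H R₁ ∧ ε < gap D β p q.1 q.2

/-- The guard of the while loop: some pair of losses violates decision calibration of `p`. -/
def LoopGuard {X Y : Type*} (A : Type*) {H : Type*} [MeasurableSpace X] [MeasurableSpace Y]
    [Fintype A] [NormedAddCommGroup H] [InnerProductSpace ℝ H] [CompleteSpace H] [RKHS ℝ H Y ℝ]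
    (D : Measure (X × Y)) (β R₁ ε : ℝ) (p : X → H) : Prop :=
  ∃ q : (A → H) × (A → H), IsViolation D β R₁ ε p q

/-- Empirical mean of `ψ` over a batch of `n` samples. -/
def empMean {Z E : Type*} [AddCommGroup E] [Module ℝ E] {n : ℕ} (S : Fin n → Z) (ψ : Z → E) : E :=
  (n : ℝ)⁻¹ • ∑ i, ψ (S i)

/-- The matrix `D̂`, with entries `Ê[k̃_{ℓ'}(x, a) k̃_{ℓ'}(x, a')]`. -/
def DHat {X Y A H : Type*} [Fintype A] [NormedAddCommGroup H] [InnerProductSpace ℝ H]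
    (β : ℝ) (p : X → H) (ℓ' : A → H) {n : ℕ} (S : Fin n → X × Y) : Matrix A A ℝ :=
  Matrix.of fun a a' => empMean S fun z =>
    smoothRule β (lossEstimator p) ℓ' z.1 a * smoothRule β (lossEstimator p) ℓ' z.1 a'

/-- The rows `Ĝₐ = Ê[(φ(y) - p(x)) k̃_{ℓ'}(x, a)]` of `Ĝ`. -/
def GHat {X Y A H : Type*} [Fintype A] [NormedAddCommGroup H] [InnerProductSpace ℝ H]
    [CompleteSpace H] [RKHS ℝ H Y ℝ]
    (β : ℝ) (p : X → H) (ℓ' : A → H) {n : ℕ} (S : Fin n → X × Y) (a : A) : H :=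
  empMean S fun z => smoothRule β (lossEstimator p) ℓ' z.1 a • (feature H z.2 - p z.1)

/-- Projection of a Hilbert space onto the closed ball of radius `R` about `0`. -/
def projBall {H : Type*} [NormedAddCommGroup H] [InnerProductSpace ℝ H] (R : ℝ) (v : H) : H :=
  open Classical in if ‖v‖ ≤ R then v else (R / ‖v‖) • v

/-- The patched predictor `x ↦ π_{B(R₂)}(p(x) + Ĝᵀ (D̂ + I)⁻¹ k̃_{ℓ'}(x))`. -/
def patch {X Y A H : Type*} [Fintype A] [DecidableEq A]
    [NormedAddCommGroup H] [InnerProductSpace ℝ H] [CompleteSpace H] [RKHS ℝ H Y ℝ]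
    (β R₂ : ℝ) (p : X → H) (ℓ' : A → H) {n : ℕ} (S : Fin n → X × Y) (x : X) : H :=
  projBall R₂ (p x + ∑ a,
    Matrix.mulVec (DHat β p ℓ' S + 1)⁻¹ (smoothRule β (lossEstimator p) ℓ' x) a • GHat β p ℓ' S a)

/-- A rule that picks the pair `(ℓ_t, ℓ'_t)` of round `t`. It may look at everything that has
happened so far, that is, at the batches of samples of the rounds before `t`. -/
abbrev Selector (X Y A H : Type*) (n : ℕ) : Type _ :=
  (t : ℕ) → (Fin t → Fin n → X × Y) → (A → H) × (A → H)

/-- The predictor `p_t`, as a function of the batches of samples of the rounds `0, …, t - 1`;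
each round uses a fresh batch of `n` samples. -/
def predictorAt {X Y A H : Type*} [Fintype A] [DecidableEq A]
    [NormedAddCommGroup H] [InnerProductSpace ℝ H] [CompleteSpace H] [RKHS ℝ H Y ℝ]
    (β R₂ : ℝ) (p₀ : X → H) {n : ℕ} (sel : Selector X Y A H n) :
    (t : ℕ) → (Fin t → Fin n → X × Y) → X → H
  | 0, _ => p₀
  | t + 1, h =>
      patch β R₂ (predictorAt β R₂ p₀ sel t (Fin.init h)) (sel t (Fin.init h)).2 (h (Fin.last t))

/-- The rule `sel` is admissible for the loop: whenever the guard holds for the current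
predictor, it picks a violating pair. -/
def IsAdmissible {X Y A H : Type*} [MeasurableSpace X] [MeasurableSpace Y]
    [Fintype A] [DecidableEq A]
    [NormedAddCommGroup H] [InnerProductSpace ℝ H] [CompleteSpace H] [RKHS ℝ H Y ℝ]
    (D : Measure (X × Y)) (β R₁ R₂ ε : ℝ) (p₀ : X → H) {n : ℕ} (sel : Selector X Y A H n) : Prop :=
  ∀ (t : ℕ) (h : Fin t → Fin n → X × Y),
    LoopGuard A D β R₁ ε (predictorAt β R₂ p₀ sel t h) →
      IsViolation D β R₁ ε (predictorAt β R₂ p₀ sel t h) (sel t h)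

/-- On the batches `h`, the loop ends after exactly `t` iterations: the guard holds
before each of the rounds `0, …, t - 1` and fails for `p_t`. -/
def EndsAt {X Y A H : Type*} [MeasurableSpace X] [MeasurableSpace Y]
    [Fintype A] [DecidableEq A]
    [NormedAddCommGroup H] [InnerProductSpace ℝ H] [CompleteSpace H] [RKHS ℝ H Y ℝ]
    (D : Measure (X × Y)) (β R₁ R₂ ε : ℝ) (p₀ : X → H) {n : ℕ} (sel : Selector X Y A H n)
    (t : ℕ) (h : Fin t → Fin n → X × Y) : Prop :=
  (∀ (s : ℕ) (hs : s < t),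
      LoopGuard A D β R₁ ε (predictorAt β R₂ p₀ sel s (Fin.take s hs.le h))) ∧
    ¬ LoopGuard A D β R₁ ε (predictorAt β R₂ p₀ sel t h)

end DecCal

end

/-! The squared error `sqError` serves as a potential: it is nonnegative and starts below 4R₂². If
every round with a violating pair lowers it by ε²/(8R₁²|A|), at most 32|A|R₁²R₂²/ε² rounds are
possible, and this is less than T as soon as p₀ itself fails the test.

Write k for the current rule and G_a = E[k_a (φ(y) − p(x))]. The gap of a loss is ∑ ⟨ℓ_a, G_a⟩
(`gap_eq_sum_inner`), so only |A| vectors have to be estimated and no uniformity over losses is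
needed. Let W = (D̂ + I)⁻¹Ĝ, so Ĝ = W + D̂W (`GHat_eq`). Paired with ℓ, this identity shows that a
violation forces ∑‖W_a‖ to be of order ε/R₁. Paired with W, it gives ⟨W, Ĝ⟩ ≥ ‖W‖², because D̂ is
positive semidefinite. The patch changes the potential by at most −2⟨W, G⟩ + ‖W‖²
(`sqError_projBall_add_le`), hence, up to the error of Ĝ, by −‖W‖² ≤ −(∑‖W_a‖)²/|A|. So D̂ is never
compared with its expectation, and accuracy ε/(16R₁|A|) of each Ĝ_a suffices (`sqError_patch_le`).

That accuracy comes from a dimension-free Hoeffding bound in Hilbert space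
(`measure_empMean_sub_ge_le`), applied to each fresh batch with the other batches frozen
(`measure_roundError_ge_le`), and a union bound over rounds and actions (`union_bound_le`). At exit,
the failed one-sided test is decision calibration because the loss class is symmetric
(`isDecCalibrated_of_not_loopGuard`). -/

namespace DecCal

/-! ### Concentration of bounded i.i.d. vectors in a Hilbert space -/

/-- Convexity of `s ↦ cosh √s`, between the points `(a - c)²` and `(a + c)²`. -/
lemma cosh_le_of_sq_eq {a c r s : ℝ} (hr : |r| ≤ 1) (hs : s ^ 2 = a ^ 2 + c ^ 2 + 2 * r * a * c) :
    Real.cosh s ≤ Real.cosh a * Real.cosh c + r * (Real.sinh a * Real.sinh c) := by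
  obtain ⟨hr1, hr2⟩ := abs_le.mp hr
  have key : Real.cosh s ≤
      (1 + r) / 2 * Real.cosh (a + c) + (1 - r) / 2 * Real.cosh (a - c) := by
    -- Termwise: cosh is a power series in s² with nonnegative coefficients, and s² is the convex
    -- combination of (a + c)² and (a − c)² with weights (1 ± r)/2.
    refine hasSum_le (fun n => ?_) (Real.hasSum_cosh s)
      (((Real.hasSum_cosh (a + c)).mul_left ((1 + r) / 2)).add
        ((Real.hasSum_cosh (a - c)).mul_left ((1 - r) / 2)))
    have hconv := (convexOn_pow (𝕜 := ℝ) n).2 (Set.mem_Ici.mpr (sq_nonneg (a + c)))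
      (Set.mem_Ici.mpr (sq_nonneg (a - c))) 
      (show 0 ≤ (1 + r) / 2 by linarith) (show 0 ≤ (1 - r) / 2 by linarith) (by ring)
    simp only [smul_eq_mul] at hconv
    rw [show (1 + r) / 2 * (a + c) ^ 2 + (1 - r) / 2 * (a - c) ^ 2 = s ^ 2 by rw [hs]; ring]
      at hconv
    simp only [pow_mul]
    rw [← mul_div_assoc, ← mul_div_assoc, ← add_div]
    gcongr
  rw [Real.cosh_add, Real.cosh_sub] at key
  linarith

section Hilbert

variable {H : Type*} [NormedAddCommGroup H] [InnerProductSpace ℝ H]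

/-- Apply `cosh_le_of_sq_eq` with r = ⟨x, d⟩/(‖x‖c). The point is that the right side is affine in
d, so a mean-zero d leaves only cosh ‖x‖ · cosh c after integration. -/
lemma cosh_norm_add_le {c : ℝ} (x d : H) (hd : ‖d‖ ≤ c) :
    Real.cosh ‖x + d‖ ≤ Real.cosh ‖x‖ * Real.cosh c +
      Real.sinh ‖x‖ * Real.sinh c / (‖x‖ * c) * inner ℝ x d := by
  have hc : 0 ≤ c := (norm_nonneg d).trans hd
  have hin : |inner ℝ x d| ≤ ‖x‖ * c := (abs_real_inner_le_norm x d).trans (by gcongr)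
  -- If ‖x‖c = 0 the quotient is 0 by convention, and the inner product vanishes as well.
  rcases eq_or_lt_of_le (mul_nonneg (norm_nonneg x) hc) with h0 | h0
  · have hin0 : inner ℝ x d = 0 := by rw [← h0] at hin; exact abs_nonpos_iff.mp hin
    rw [hin0]
    rcases mul_eq_zero.mp h0.symm with h | h
    · have hx : x = 0 := norm_eq_zero.mp h
      simpa [hx, abs_of_nonneg hc] using hd
    · have hd0 : d = 0 := norm_le_zero_iff.mp (h ▸ hd)
      simp [hd0, h]
  · have hsq : ‖x + d‖ ^ 2 = ‖x‖ ^ 2 + 2 * inner ℝ x d + ‖d‖ ^ 2 := norm_add_sq_real x d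
    set r : ℝ := inner ℝ x d / (‖x‖ * c) with hr
    have hr1 : |r| ≤ 1 := by
      rw [hr, abs_div, abs_of_pos h0]
      exact (div_le_one h0).mpr hin
    have hrx : r * ‖x‖ * c = inner ℝ x d := by rw [mul_assoc, hr, div_mul_cancel₀ _ h0.ne']
    set S : ℝ := ‖x‖ ^ 2 + c ^ 2 + 2 * r * ‖x‖ * c with hS
    have hSle : ‖x + d‖ ^ 2 ≤ S := by
      rw [hsq, hS, show 2 * r * ‖x‖ * c = 2 * (r * ‖x‖ * c) by ring, hrx]
      have := pow_le_pow_left₀ (norm_nonneg d) hd 2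
      linarith
    have h1 : Real.cosh ‖x + d‖ ≤ Real.cosh (Real.sqrt S) := by
      rw [Real.cosh_le_cosh, abs_of_nonneg (norm_nonneg _), abs_of_nonneg (Real.sqrt_nonneg _)]
      exact Real.le_sqrt_of_sq_le hSle
    have h2 := cosh_le_of_sq_eq hr1 (Real.sq_sqrt ((sq_nonneg _).trans hSle))
    refine h1.trans (h2.trans (le_of_eq ?_))
    rw [hr]; ring

variable [CompleteSpace H] [TopologicalSpace.SeparableSpace H] [MeasurableSpace H] [BorelSpace H]
variable {Z : Type*} [MeasurableSpace Z]

lemma integrable_of_norm_le {μ : Measure Z} [IsFiniteMeasure μ] {E : Type*} [NormedAddCommGroup E]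
    [TopologicalSpace.SeparableSpace E] [MeasurableSpace E] [BorelSpace E]
    {f : Z → E} (hf : Measurable f) (c : ℝ) (hc : ∀ z, ‖f z‖ ≤ c) : Integrable f μ := by
  have : SecondCountableTopology E := UniformSpace.secondCountable_of_separable E
  exact Integrable.of_bound hf.aestronglyMeasurable c (Filter.Eventually.of_forall hc)

/-- Induction on n, peeling off one variable and absorbing it into the starting point x, which is
therefore arbitrary. Each variable costs a factor cosh c, since the linear term of
`cosh_norm_add_le` integrates to zero. -/
lemma integral_cosh_norm_sum_le (D : Measure Z) [IsProbabilityMeasure D] {g : Z → H}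
    (hg : Measurable g) {c : ℝ} (hc : ∀ z, ‖g z‖ ≤ c) (h0 : ∫ z, g z ∂D = 0) (n : ℕ) (x : H) :
    ∫ S, Real.cosh ‖x + ∑ i, g (S i)‖ ∂(Measure.pi fun _ : Fin n => D) ≤
      Real.cosh ‖x‖ * Real.cosh c ^ n := by
  have : SecondCountableTopology H := UniformSpace.secondCountable_of_separable H
  have hint : ∀ (n : ℕ) (x : H), Integrable (fun S : Fin n → Z => Real.cosh ‖x + ∑ i, g (S i)‖)
      (Measure.pi fun _ : Fin n => D) := by
    intro n x
    refine integrable_of_norm_le ?_ (Real.cosh (‖x‖ + n * c)) fun S => ?_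
    · exact Real.measurable_cosh.comp (by fun_prop)
    · rw [Real.norm_eq_abs, abs_of_pos (Real.cosh_pos _), Real.cosh_le_cosh, abs_norm]
      refine le_trans ?_ (le_abs_self _)
      refine (norm_add_le _ _).trans ?_
      gcongr
      refine (norm_sum_le _ _).trans ((Finset.sum_le_sum fun i _ => hc (S i)).trans ?_)
      simp
  induction n generalizing x with
  | zero => simp
  | succ n ih =>
    have e := measurePreserving_piFinSuccAbove (fun _ : Fin (n + 1) => D) 0
    have hcomp : ∀ S : Fin (n + 1) → Z, Real.cosh ‖x + ∑ i, g (S i)‖ =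
        (fun q : Z × (Fin n → Z) => Real.cosh ‖(x + g q.1) + ∑ i, g (q.2 i)‖)
          (MeasurableEquiv.piFinSuccAbove (fun _ : Fin (n + 1) => Z) 0 S) := by
      intro S
      simp only [Fin.sum_univ_succ, MeasurableEquiv.piFinSuccAbove_apply]
      simp [Fin.insertNthEquiv, Fin.tail, add_assoc]
    have hI : Integrable (fun q : Z × (Fin n → Z) => Real.cosh ‖(x + g q.1) + ∑ i, g (q.2 i)‖)
        (D.prod (Measure.pi fun _ : Fin n => D)) := by
      have h := hint (n + 1) x
      simp only [hcomp] at h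
      exact (e.integrable_comp_emb (MeasurableEquiv.measurableEmbedding _)).mp h
    simp only [hcomp]
    rw [e.integral_comp' (g := fun q : Z × (Fin n → Z) =>
      Real.cosh ‖(x + g q.1) + ∑ i, g (q.2 i)‖), integral_prod _ hI]
    have hgi : Integrable g D := integrable_of_norm_le hg c hc
    have hz : Integrable (fun z => Real.cosh ‖x + g z‖ * Real.cosh c ^ n) D := by
      refine Integrable.mul_const (integrable_of_norm_le
        (Real.measurable_cosh.comp (by fun_prop)) (Real.cosh (‖x‖ + c)) fun z => ?_) _
      change ‖Real.cosh ‖x + g z‖‖ ≤ _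
      rw [Real.norm_eq_abs, abs_of_pos (Real.cosh_pos _), Real.cosh_le_cosh, abs_norm]
      refine le_trans ((norm_add_le _ _).trans ?_) (le_abs_self _)
      gcongr
      exact hc z
    calc ∫ z, ∫ S, Real.cosh ‖(x + g z) + ∑ i, g (S i)‖ ∂(Measure.pi fun _ : Fin n => D) ∂D
        ≤ ∫ z, Real.cosh ‖x + g z‖ * Real.cosh c ^ n ∂D :=
          integral_mono hI.integral_prod_left hz fun z => ih (x + g z)
      _ ≤ ∫ z, (Real.cosh ‖x‖ * Real.cosh c +
            Real.sinh ‖x‖ * Real.sinh c / (‖x‖ * c) * inner ℝ x (g z)) * Real.cosh c ^ n ∂D := by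
          refine integral_mono hz ?_ fun z => ?_
          · exact ((integrable_const _).add ((hgi.const_inner x).const_mul _)).mul_const _
          · have := cosh_norm_add_le x (g z) (hc z)
            have := Real.cosh_pos c
            dsimp only
            gcongr
      _ = Real.cosh ‖x‖ * Real.cosh c ^ (n + 1) := by
          rw [integral_mul_const, integral_add (integrable_const _) ((hgi.const_inner x).const_mul _),
            integral_const_mul (Real.sinh ‖x‖ * Real.sinh c / (‖x‖ * c)), integral_inner hgi, h0]
          simp
          ring

lemma measure_norm_sum_ge_le (D : Measure Z) [IsProbabilityMeasure D] {g : Z → H}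
    (hg : Measurable g) {c : ℝ} (hc0 : 0 < c) (hc : ∀ z, ‖g z‖ ≤ c) (h0 : ∫ z, g z ∂D = 0) (n : ℕ)
    {η : ℝ} (hη : 0 < η) :
    (Measure.pi fun _ : Fin n => D) {S | n * η ≤ ‖∑ i, g (S i)‖} ≤
      ENNReal.ofReal (2 * Real.exp (-(n * η ^ 2 / (2 * c ^ 2)))) := by
  have : SecondCountableTopology H := UniformSpace.secondCountable_of_separable H
  let P := Measure.pi fun _ : Fin n => D
  -- The Chernoff parameter: it minimises −lη + l²c²/2, the exponent per sample after cosh(lc) ≤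
  -- exp(l²c²/2).
  obtain ⟨l, hl⟩ : ∃ l : ℝ, l = η / c ^ 2 := ⟨_, rfl⟩
  have hl0 : 0 < l := by rw [hl]; positivity
  have hmean := integral_cosh_norm_sum_le D (g := fun z => l • g z) (hg.const_smul l) (c := l * c)
    (fun z => by rw [norm_smul, Real.norm_eq_abs, abs_of_pos hl0]; gcongr; exact hc z)
    (by rw [integral_smul, h0, smul_zero]) n 0
  simp only [zero_add, norm_zero, Real.cosh_zero, one_mul] at hmean
  have hmeas : Measurable fun S : Fin n → Z => Real.cosh ‖∑ i, l • g (S i)‖ :=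
    Real.measurable_cosh.comp (by fun_prop)
  have hint : Integrable (fun S : Fin n → Z => Real.cosh ‖∑ i, l • g (S i)‖) P := by
    refine integrable_of_norm_le hmeas (Real.cosh (n * (l * c))) fun S => ?_
    rw [Real.norm_eq_abs, abs_of_pos (Real.cosh_pos _), Real.cosh_le_cosh, abs_norm]
    refine le_trans ?_ (le_abs_self _)
    refine (norm_sum_le_of_le (f := fun i => l • g (S i)) Finset.univ (n := fun _ => l * c)
      fun i _ => ?_).trans (by simp)
    rw [norm_smul, Real.norm_eq_abs, abs_of_pos hl0]; gcongr; exact hc _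
  have hmarkov : Real.exp (l * (n * η)) / 2 *
      P.real {S | Real.exp (l * (n * η)) / 2 ≤ Real.cosh ‖∑ i, l • g (S i)‖} ≤
      ∫ S, Real.cosh ‖∑ i, l • g (S i)‖ ∂P := by
    refine mul_meas_ge_le_integral_of_nonneg (Filter.Eventually.of_forall fun S => ?_) hint _
    exact (Real.cosh_pos _).le
  have hsub : {S : Fin n → Z | n * η ≤ ‖∑ i, g (S i)‖} ⊆
      {S | Real.exp (l * (n * η)) / 2 ≤ Real.cosh ‖∑ i, l • g (S i)‖} := by
    intro S hS
    simp only [Set.mem_ofPred_eq] at hS ⊢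
    rw [← Finset.smul_sum, norm_smul, Real.norm_eq_abs, abs_of_pos hl0, Real.cosh_eq]
    have h1 : Real.exp (l * (n * η)) ≤ Real.exp (l * ‖∑ i, g (S i)‖) :=
      Real.exp_le_exp.mpr (by gcongr)
    have := Real.exp_pos (-(l * ‖∑ i, g (S i)‖))
    linarith
  have hcosh : Real.cosh (l * c) ^ n ≤ Real.exp (n * ((l * c) ^ 2 / 2)) := by
    rw [Real.exp_nat_mul]
    exact pow_le_pow_left₀ (Real.cosh_pos _).le (Real.cosh_le_exp_half_sq _) n
  have hle : P.real {S : Fin n → Z | n * η ≤ ‖∑ i, g (S i)‖} ≤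
      P.real {S | Real.exp (l * (n * η)) / 2 ≤ Real.cosh ‖∑ i, l • g (S i)‖} :=
    measureReal_mono hsub (measure_ne_top P _)
  have hE := Real.exp_pos (l * (n * η))
  have hle2 : P.real {S | Real.exp (l * (n * η)) / 2 ≤ Real.cosh ‖∑ i, l • g (S i)‖} *
      Real.exp (l * (n * η)) ≤ 2 * Real.exp (n * ((l * c) ^ 2 / 2)) := by
    linarith [hmarkov.trans (hmean.trans hcosh)]
  rw [← le_div_iff₀ hE, mul_div_assoc, ← Real.exp_sub] at hle2
  rw [← ofReal_measureReal (measure_ne_top P _)]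
  refine ENNReal.ofReal_le_ofReal (hle.trans (hle2.trans (le_of_eq ?_)))
  congr 2
  rw [hl]; field_simp; ring

lemma measure_empMean_sub_ge_le (D : Measure Z) [IsProbabilityMeasure D] {f : Z → H}
    (hf : Measurable f) {c : ℝ} (hc0 : 0 < c) (hc : ∀ z, ‖f z‖ ≤ c) {n : ℕ} (hn : 0 < n)
    {η : ℝ} (hη : 0 < η) :
    (Measure.pi fun _ : Fin n => D) {S | η ≤ ‖empMean S f - ∫ z, f z ∂D‖} ≤
      ENNReal.ofReal (2 * Real.exp (-(n * η ^ 2 / (8 * c ^ 2)))) := by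
  have : SecondCountableTopology H := UniformSpace.secondCountable_of_separable H
  have hn' : (0 : ℝ) < n := by exact_mod_cast hn
  have hfi : Integrable f D := integrable_of_norm_le hf c hc
  set m := ∫ z, f z ∂D with hm
  have hmc : ‖m‖ ≤ c := by
    simpa using norm_integral_le_of_norm_le_const (μ := D) (Filter.Eventually.of_forall hc)
  -- Centring at most doubles the bound c, which turns 2c² into 8c² in the exponent.
  have h := measure_norm_sum_ge_le D (g := fun z => f z - m) (hf.sub_const m) (c := 2 * c)
    (by positivity) (fun z => (norm_sub_le _ _).trans (by linarith [hc z]))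
    (by rw [integral_sub hfi (integrable_const _)]; simp [hm]) n hη
  refine (measure_mono fun S hS => ?_).trans (h.trans (le_of_eq (by ring_nf)))
  simp only [Set.mem_ofPred_eq] at hS ⊢
  have hsum : ∑ i, (f (S i) - m) = (n : ℝ) • (empMean S f - m) := by
    rw [smul_sub, empMean, smul_inv_smul₀ hn'.ne', Finset.sum_sub_distrib]
    simp [Nat.cast_smul_eq_nsmul]
  rw [hsum, norm_smul, Real.norm_of_nonneg hn'.le]
  gcongr

end Hilbert

/-- A measurable set of a finite product has small measure if its slices in one direction do. -/
lemma measure_pi_le_of_update_le {Z : Type*} [MeasurableSpace Z] (P : Measure Z)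
    [IsProbabilityMeasure P] {T : ℕ} (t : Fin T) {B : Set (Fin T → Z)} (hB : MeasurableSet B)
    (c : ℝ≥0∞) (h : ∀ ω, P {z | Function.update ω t z ∈ B} ≤ c) :
    (Measure.pi fun _ : Fin T => P) B ≤ c := by
  obtain _ | T := T
  · exact t.elim0
  have : Nonempty Z := P.nonempty_of_neZero
  obtain ⟨z₀⟩ := this
  have e := (measurePreserving_piFinSuccAbove (fun _ : Fin (T + 1) => P) t).symm
  rw [← e.measure_preimage hB.nullMeasurableSet,
    Measure.prod_apply_symm (MeasurableEquiv.measurable _ hB)]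
  refine (lintegral_mono (g := fun _ => c) fun ω => ?_).trans (by simp)
  -- The choice of z₀ is immaterial, since the update overwrites coordinate t.
  convert h (t.insertNth z₀ ω) using 2
  ext z
  simp only [Set.mem_preimage, Set.mem_ofPred_eq, Fin.update_insertNth]
  rfl

/-! ### Decision rules are probability vectors -/

section SmoothRule

variable {X A L : Type*} [Fintype A] (β : ℝ) (f : X → A → L → ℝ) (ℓ : L) (x : X)

lemma smoothRule_nonneg (a : A) : 0 ≤ smoothRule β f ℓ x a := by
  unfold smoothRule; positivity

lemma sum_smoothRule [Nonempty A] : ∑ a, smoothRule β f ℓ x a = 1 := by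
  unfold smoothRule
  rw [← Finset.sum_div]
  exact div_self (Finset.sum_pos (fun a _ => Real.exp_pos _) Finset.univ_nonempty).ne'

lemma smoothRule_le_one [Nonempty A] (a : A) : smoothRule β f ℓ x a ≤ 1 := by
  rw [← sum_smoothRule β f ℓ x]
  exact Finset.single_le_sum (fun b _ => smoothRule_nonneg β f ℓ x b) (Finset.mem_univ a)

end SmoothRule

lemma norm_projBall_le {H : Type*} [NormedAddCommGroup H] [InnerProductSpace ℝ H] {R : ℝ}
    (hR : 0 ≤ R) (v : H) : ‖projBall R v‖ ≤ R := by
  unfold projBall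
  split_ifs with h
  · exact h
  · have hv : 0 < ‖v‖ := hR.trans_lt (not_le.mp h)
    rw [norm_smul, Real.norm_of_nonneg (by positivity), div_mul_cancel₀ _ hv.ne']

/-! ### Joint measurability of the predictors in the samples and the feature -/

section Measurability

variable {Ω X Y A H : Type*} [MeasurableSpace Ω] [MeasurableSpace X] [MeasurableSpace Y]
  [Fintype A] [NormedAddCommGroup H] [InnerProductSpace ℝ H] [CompleteSpace H]
  [SecondCountableTopology H] [MeasurableSpace H] [BorelSpace H] [RKHS ℝ H Y ℝ]

omit [CompleteSpace H] [RKHS ℝ H Y ℝ] in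
lemma measurable_projBall (R : ℝ) : Measurable (projBall R : H → H) := by
  classical
  unfold projBall
  refine Measurable.ite (measurableSet_le measurable_norm measurable_const) measurable_id ?_
  fun_prop

omit [CompleteSpace H] in
lemma measurable_smoothRule (β : ℝ) {P : Ω → X → H}
    (hP : Measurable (Function.uncurry P)) {L : Ω → A → H} (hL : Measurable L) (a : A) :
    Measurable fun q : Ω × X => smoothRule β (lossEstimator (P q.1)) (L q.1) q.2 a := by
  have h : ∀ a, Measurable fun q : Ω × X => lossEstimator (P q.1) q.2 a (L q.1) := fun a =>
    (((measurable_pi_apply a).comp hL).comp measurable_fst).inner hP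
  unfold smoothRule
  exact (Real.measurable_exp.comp ((h a).const_mul _)).div
    (Finset.measurable_fun_sum _ fun b _ => Real.measurable_exp.comp ((h b).const_mul _))

/-- The integrand `k̃(x, a) (φ(y) - p(x))` of the correlation of the residual with the rule. -/
noncomputable def residual (β : ℝ) (p : X → H) (ℓ : A → H) (a : A) (z : X × Y) : H :=
  smoothRule β (lossEstimator p) ℓ z.1 a • (feature H z.2 - p z.1)

lemma measurable_residual (hφ : Measurable fun y : Y => feature H y) (β : ℝ) {P : Ω → X → H}
    (hP : Measurable (Function.uncurry P)) {L : Ω → A → H} (hL : Measurable L) (a : A) :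
    Measurable fun q : Ω × (X × Y) => residual β (P q.1) (L q.1) a q.2 := by
  have hπ : Measurable fun q : Ω × (X × Y) => (q.1, q.2.1) := by fun_prop
  exact ((measurable_smoothRule β hP hL a).comp hπ).smul
    ((hφ.comp (measurable_snd.comp measurable_snd)).sub (hP.comp hπ))

lemma measurable_empMean {E : Type*} [NormedAddCommGroup E] [NormedSpace ℝ E]
    [MeasurableSpace E] [BorelSpace E] [SecondCountableTopology E] {Z : Type*} [MeasurableSpace Z]
    {n : ℕ} {S : Ω → Fin n → Z} (hS : Measurable S) {ψ : Ω → Z → E}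
    (hψ : Measurable (Function.uncurry ψ)) : Measurable fun ω => empMean (S ω) (ψ ω) := by
  unfold empMean
  refine Measurable.const_smul (Finset.measurable_fun_sum _ fun i _ => ?_) _
  exact hψ.comp (measurable_id.prodMk ((measurable_pi_apply i).comp hS))

lemma measurable_GHat (hφ : Measurable fun y : Y => feature H y) (β : ℝ) {P : Ω → X → H}
    (hP : Measurable (Function.uncurry P)) {L : Ω → A → H} (hL : Measurable L) {n : ℕ}
    {S : Ω → Fin n → X × Y} (hS : Measurable S) (a : A) :
    Measurable fun ω => GHat β (P ω) (L ω) (S ω) a :=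
  measurable_empMean hS (measurable_residual hφ β hP hL a)

omit [CompleteSpace H] [RKHS ℝ H Y ℝ] in
lemma measurable_DHat_apply (β : ℝ) {P : Ω → X → H}
    (hP : Measurable (Function.uncurry P)) {L : Ω → A → H} (hL : Measurable L) {n : ℕ}
    {S : Ω → Fin n → X × Y} (hS : Measurable S) (a b : A) :
    Measurable fun ω => DHat β (P ω) (L ω) (S ω) a b := by
  have hπ : Measurable fun q : Ω × (X × Y) => (q.1, q.2.1) := by fun_prop
  exact measurable_empMean hS (ψ := fun ω z => smoothRule β (lossEstimator (P ω)) (L ω) z.1 a *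
    smoothRule β (lossEstimator (P ω)) (L ω) z.1 b) <|
    ((measurable_smoothRule β hP hL a).comp hπ).mul ((measurable_smoothRule β hP hL b).comp hπ)

/-- The inverse is the adjugate divided by the determinant, both polynomial in the entries. Real
inversion is measurable with 0⁻¹ = 0, so singular matrices need no separate treatment. -/
lemma measurable_matrix_inv_apply [DecidableEq A] {B : Ω → Matrix A A ℝ}
    (hB : ∀ a b, Measurable fun ω => B ω a b) (a b : A) :
    Measurable fun ω => (B ω)⁻¹ a b := by
  have hdet : ∀ C : Ω → Matrix A A ℝ, (∀ a b, Measurable fun ω => C ω a b) →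
      Measurable fun ω => (C ω).det := by
    intro C hC
    simp only [Matrix.det_apply]
    refine Finset.measurable_fun_sum _ fun σ _ => ?_
    exact (Finset.measurable_fun_prod _ fun i _ => hC _ _).const_smul _
  simp only [Matrix.inv_def, Ring.inverse_eq_inv', Matrix.smul_apply, smul_eq_mul,
    Matrix.adjugate_apply]
  refine (hdet B hB).inv.mul (hdet _ fun c d => ?_)
  by_cases h : c = b
  · subst h; simp
  · simpa [Matrix.updateRow_apply, h] using hB c d

variable [DecidableEq A]

lemma measurable_patch (hφ : Measurable fun y : Y => feature H y) (β R₂ : ℝ) {P : Ω → X → H}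
    (hP : Measurable (Function.uncurry P)) {L : Ω → A → H} (hL : Measurable L) {n : ℕ}
    {S : Ω → Fin n → X × Y} (hS : Measurable S) :
    Measurable fun q : Ω × X => patch β R₂ (P q.1) (L q.1) (S q.1) q.2 := by
  unfold patch
  refine (measurable_projBall (H := H) R₂).comp
    (Measurable.add (f := fun q : Ω × X => P q.1 q.2) hP
      (Finset.measurable_fun_sum _ fun a _ => ?_))
  refine Measurable.smul ?_ ((measurable_GHat hφ β hP hL hS a).comp measurable_fst)
  simp only [Matrix.mulVec, dotProduct]
  refine Finset.measurable_fun_sum _ fun b _ => Measurable.mul ?_ (measurable_smoothRule β hP hL b)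
  have hinv := measurable_matrix_inv_apply (B := fun ω => DHat β (P ω) (L ω) (S ω) + 1)
    (fun c d => (measurable_DHat_apply β hP hL hS c d).add measurable_const) a b
  exact hinv.comp measurable_fst

/-- Joint measurability makes expectations over a new (x, y) measurable functions of the past
batches, as the Fubini argument for the error events requires. -/
lemma measurable_predictorAt (hφ : Measurable fun y : Y => feature H y) (β R₂ : ℝ) {p₀ : X → H}
    (hp₀ : Measurable p₀) {n : ℕ} {sel : Selector X Y A H n} (hsel : ∀ t, Measurable (sel t))
    (t : ℕ) : Measurable (Function.uncurry (predictorAt β R₂ p₀ sel t)) := by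
  induction t with
  | zero => exact hp₀.comp measurable_snd
  | succ t ih =>
    have hinit : Measurable fun h : Fin (t + 1) → Fin n → X × Y => Fin.init h :=
      measurable_pi_lambda _ fun i => measurable_pi_apply _
    refine measurable_patch hφ β R₂
      (P := fun h : Fin (t + 1) → Fin n → X × Y => predictorAt β R₂ p₀ sel t (Fin.init h))
      (L := fun h => (sel t (Fin.init h)).2) (S := fun h => h (Fin.last t)) ?_ ?_ ?_
    · exact ih.comp ((hinit.comp measurable_fst).prodMk measurable_snd)
    · exact measurable_snd.comp ((hsel t).comp hinit)
    · exact measurable_pi_apply _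

lemma measurable_predictorAt_apply (hφ : Measurable fun y : Y => feature H y) (β R₂ : ℝ)
    {p₀ : X → H} (hp₀ : Measurable p₀) {n : ℕ} {sel : Selector X Y A H n}
    (hsel : ∀ t, Measurable (sel t)) (t : ℕ) (h : Fin t → Fin n → X × Y) :
    Measurable (predictorAt β R₂ p₀ sel t h) :=
  (measurable_predictorAt hφ β R₂ hp₀ hsel t).comp measurable_prodMk_left

omit [MeasurableSpace X] [MeasurableSpace Y] [SecondCountableTopology H] [MeasurableSpace H]
  [BorelSpace H] in
lemma norm_predictorAt_le (β : ℝ) {R₂ : ℝ} (hR₂ : 0 ≤ R₂) {p₀ : X → H} (hp₀ : ∀ x, ‖p₀ x‖ ≤ R₂)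
    {n : ℕ} (sel : Selector X Y A H n) (t : ℕ) (h : Fin t → Fin n → X × Y) (x : X) :
    ‖predictorAt β R₂ p₀ sel t h x‖ ≤ R₂ := by
  cases t with
  | zero => exact hp₀ x
  | succ t => exact norm_projBall_le hR₂ _

end Measurability

/-! ### Kernel expansions -/

section KernelExpansion

variable {X Y A H : Type*} [NormedAddCommGroup H] [InnerProductSpace ℝ H] [CompleteSpace H]
  [RKHS ℝ H Y ℝ]

/-- The finite set is uniform in x while the coefficients are free, so stability under patching
reduces to closure of a span. -/
lemma isKernelExpansion_iff {p : X → H} :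
    IsKernelExpansion p ↔
      ∃ s : Set Y, s.Finite ∧ ∀ x, p x ∈ Submodule.span ℝ (feature H '' s) := by
  constructor
  · rintro ⟨m, α, y, h⟩
    refine ⟨Set.range y, Set.finite_range y, fun x => h x ▸ Submodule.sum_mem _ fun i _ => ?_⟩
    exact Submodule.smul_mem _ _ (Submodule.subset_span ⟨y i, ⟨i, rfl⟩, rfl⟩)
  · rintro ⟨s, hs, h⟩
    have := hs.to_subtype
    obtain ⟨m, ⟨e⟩⟩ := Finite.exists_equiv_fin s
    have hrange : feature H '' s = Set.range fun i => feature H (e.symm i : Y) := by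
      ext v
      exact ⟨fun ⟨y, hy, hv⟩ => ⟨e ⟨y, hy⟩, by simpa using hv⟩,
        fun ⟨i, hi⟩ => ⟨e.symm i, (e.symm i).2, hi⟩⟩
    simp only [hrange, Submodule.mem_span_range_iff_exists_fun] at h
    choose c hc using h
    exact ⟨m, fun i x => c x i, fun i => e.symm i, fun x => (hc x).symm⟩

variable [Fintype A] [DecidableEq A]

lemma IsKernelExpansion.patch {p : X → H} (hp : IsKernelExpansion p) (β R₂ : ℝ) (ℓ' : A → H)
    {n : ℕ} (S : Fin n → X × Y) : IsKernelExpansion (patch β R₂ p ℓ' S) := by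
  rw [isKernelExpansion_iff] at hp ⊢
  obtain ⟨s, hs, h⟩ := hp
  -- The only new outcomes are those of the batch.
  refine ⟨s ∪ Set.range fun i => (S i).2, hs.union (Set.finite_range _), fun x => ?_⟩
  have h' : ∀ x, p x ∈ Submodule.span ℝ (feature H '' (s ∪ Set.range fun i => (S i).2)) :=
    fun x => Submodule.span_mono (Set.image_mono Set.subset_union_left) (h x)
  have hG : ∀ a, GHat β p ℓ' S a ∈
      Submodule.span ℝ (feature H '' (s ∪ Set.range fun i => (S i).2)) := fun a =>
    Submodule.smul_mem _ _ <| Submodule.sum_mem _ fun i _ => Submodule.smul_mem _ _ <|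
      Submodule.sub_mem _ (Submodule.subset_span ⟨(S i).2, Or.inr ⟨i, rfl⟩, rfl⟩) (h' _)
  have hsum := Submodule.add_mem _ (h' x) (Submodule.sum_mem (t := Finset.univ) _ fun a _ =>
    Submodule.smul_mem _
      (Matrix.mulVec (DHat β p ℓ' S + 1)⁻¹ (smoothRule β (lossEstimator p) ℓ' x) a) (hG a))
  unfold DecCal.patch projBall
  split_ifs
  · exact hsum
  · exact Submodule.smul_mem _ _ hsum

lemma IsKernelExpansion.predictorAt {p₀ : X → H} (hp : IsKernelExpansion p₀) (β R₂ : ℝ) {n : ℕ}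
    (sel : Selector X Y A H n) (t : ℕ) (h : Fin t → Fin n → X × Y) :
    IsKernelExpansion (predictorAt β R₂ p₀ sel t h) := by
  induction t with
  | zero => exact hp
  | succ t ih => exact (ih (Fin.init h)).patch β R₂ _ _

end KernelExpansion

/-! ### One patching step decreases the squared error -/

/-- Since φ(y) lies in the ball, this makes the projection harmless for the potential. Outside the
ball, the difference of the squared distances is at least (‖v‖ − R)². -/
lemma norm_projBall_sub_le {H : Type*} [NormedAddCommGroup H] [InnerProductSpace ℝ H] {R : ℝ}
    {w : H} (hw : ‖w‖ ≤ R) (v : H) : ‖projBall R v - w‖ ≤ ‖v - w‖ := by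
  unfold projBall
  split_ifs with h
  · exact le_rfl
  · have hR : 0 ≤ R := (norm_nonneg w).trans hw
    have hlt : R < ‖v‖ := not_le.mp h
    have hv : 0 < ‖v‖ := hR.trans_lt hlt
    refine le_of_sq_le_sq ?_ (norm_nonneg _)
    rw [norm_sub_sq_real, norm_sub_sq_real, norm_smul, real_inner_smul_left,
      Real.norm_of_nonneg (by positivity), div_mul_cancel₀ _ hv.ne']
    have h1 : inner ℝ v w ≤ ‖v‖ * R := (real_inner_le_norm v w).trans (by gcongr)
    have h2 : (1 - R / ‖v‖) * inner ℝ v w ≤ (1 - R / ‖v‖) * (‖v‖ * R) :=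
      mul_le_mul_of_nonneg_left h1 (sub_nonneg.mpr ((div_le_one hv).mpr hlt.le))
    have h3 : (1 - R / ‖v‖) * (‖v‖ * R) = (‖v‖ - R) * R := by field_simp
    nlinarith [sq_nonneg (‖v‖ - R)]

section EmpMean

variable {Z : Type*} {n : ℕ} (S : Fin n → Z)

lemma empMean_nonneg {ψ : Z → ℝ} (h : ∀ z, 0 ≤ ψ z) : 0 ≤ empMean S ψ :=
  smul_nonneg (by positivity) (Finset.sum_nonneg fun i _ => h (S i))

lemma empMean_le {ψ : Z → ℝ} {c : ℝ} (hc : 0 ≤ c) (h : ∀ z, ψ z ≤ c) : empMean S ψ ≤ c := by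
  unfold empMean
  -- The mean of an empty batch is 0 because 0⁻¹ = 0; hence the assumption 0 ≤ c.
  obtain rfl | hn := Nat.eq_zero_or_pos n
  · simpa using hc
  · have hn' : (0 : ℝ) < n := by exact_mod_cast hn
    rw [smul_eq_mul, inv_mul_le_iff₀ hn']
    exact (Finset.sum_le_sum fun i _ => h (S i)).trans (by simp)

end EmpMean

/-! ### Averages of vectors over a probability vector -/

section WeightedSum

variable {A E : Type*} [Fintype A] [NormedAddCommGroup E] [NormedSpace ℝ E] {k : A → ℝ}

lemma norm_sum_smul_le_of_norm_le (hk : ∀ a, 0 ≤ k a) (hk1 : ∑ a, k a = 1) {V : A → E} {R : ℝ}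
    (hV : ∀ a, ‖V a‖ ≤ R) : ‖∑ a, k a • V a‖ ≤ R := by
  refine (norm_sum_le_of_le (n := fun a => k a * R) _ fun a _ => ?_).trans
    (by rw [← Finset.sum_mul, hk1, one_mul])
  rw [norm_smul, Real.norm_of_nonneg (hk a)]
  exact mul_le_mul_of_nonneg_left (hV a) (hk a)

lemma norm_sum_smul_le_sum_norm (hk : ∀ a, 0 ≤ k a) (hk1 : ∑ a, k a = 1) (W : A → E) :
    ‖∑ a, k a • W a‖ ≤ ∑ a, ‖W a‖ :=
  norm_sum_smul_le_of_norm_le hk hk1 fun a =>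
    Finset.single_le_sum (f := fun a => ‖W a‖) (fun _ _ => norm_nonneg _) (Finset.mem_univ a)

/-- Cauchy–Schwarz with ∑ k² ≤ ∑ k = 1. This bounds the population quadratic term of a patch without
reference to D̂. -/
lemma norm_sum_smul_sq_le (hk : ∀ a, 0 ≤ k a) (hk1 : ∑ a, k a = 1) (W : A → E) :
    ‖∑ a, k a • W a‖ ^ 2 ≤ ∑ a, ‖W a‖ ^ 2 := by
  have h1 : ‖∑ a, k a • W a‖ ≤ ∑ a, k a * ‖W a‖ :=
    norm_sum_le_of_le _ fun a _ => by rw [norm_smul, Real.norm_of_nonneg (hk a)]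
  have hle : ∀ a, k a ≤ 1 := fun a => hk1 ▸
    Finset.single_le_sum (fun b _ => hk b) (Finset.mem_univ a)
  have h2 : ∑ a, k a ^ 2 ≤ 1 := hk1 ▸ Finset.sum_le_sum fun a _ => by nlinarith [hk a, hle a]
  calc ‖∑ a, k a • W a‖ ^ 2 ≤ (∑ a, k a * ‖W a‖) ^ 2 := pow_le_pow_left₀ (norm_nonneg _) h1 2
    _ ≤ (∑ a, k a ^ 2) * ∑ a, ‖W a‖ ^ 2 := Finset.sum_mul_sq_le_sq_mul_sq _ _ _
    _ ≤ 1 * ∑ a, ‖W a‖ ^ 2 := by gcongr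
    _ = _ := one_mul _

end WeightedSum

/-! ### The regularised linear system (D̂ + I)W = Ĝ -/

section Empirical

variable {X Y A H : Type*} [Fintype A] [NormedAddCommGroup H] [InnerProductSpace ℝ H]
  (β : ℝ) (p : X → H) (ℓ' : A → H) {n : ℕ} (S : Fin n → X × Y)

/-- D̂ is the empirical mean of k kᵀ. This yields positivity for V = W and bounds through averages
over actions otherwise; the space E is free so that scalar vectors are also covered. -/
lemma sum_inner_DHat {E : Type*} [NormedAddCommGroup E] [InnerProductSpace ℝ E] (V W : A → E) :
    ∑ c, inner ℝ (V c) (∑ b, DHat β p ℓ' S c b • W b) =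
      empMean S fun z => inner ℝ (∑ c, smoothRule β (lossEstimator p) ℓ' z.1 c • V c)
        (∑ b, smoothRule β (lossEstimator p) ℓ' z.1 b • W b) := by
  simp only [DHat, empMean, Matrix.of_apply, inner_sum, sum_inner, real_inner_smul_left,
    real_inner_smul_right, smul_eq_mul, Finset.mul_sum, Finset.sum_mul]
  conv_lhs => rw [Finset.sum_comm]
  conv_rhs => rw [Finset.sum_comm]
  refine Finset.sum_congr rfl fun b _ => ?_
  rw [Finset.sum_comm]
  exact Finset.sum_congr rfl fun i _ => Finset.sum_congr rfl fun c _ => by ring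

lemma DHat_isSymm : (DHat β p ℓ' S).IsSymm := by
  ext a b
  simp [DHat, Matrix.transpose_apply, mul_comm]

variable [DecidableEq A]

/-- A kernel vector v satisfies ⟨v, D̂v⟩ = −‖v‖², while D̂ is positive semidefinite. -/
lemma isUnit_DHat_add_one : IsUnit (DHat β p ℓ' S + 1) := by
  rw [← Matrix.mulVec_injective_iff_isUnit]
  refine (injective_iff_map_eq_zero (Matrix.mulVecLin (DHat β p ℓ' S + 1))).mpr fun v hv => ?_
  have h1 := sum_inner_DHat β p ℓ' S v v
  have h2 : 0 ≤ ∑ c, inner ℝ (v c) (∑ b, DHat β p ℓ' S c b • v b) :=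
    h1 ▸ empMean_nonneg S fun z => real_inner_self_nonneg
  have h3 : ∀ c, ∑ b, DHat β p ℓ' S c b • v b = -v c := by
    intro c
    have := congrFun hv c
    rw [Matrix.mulVecLin_apply, Matrix.add_mulVec, Matrix.one_mulVec] at this
    exact eq_neg_of_add_eq_zero_left this
  simp only [h3, inner_neg_right, Finset.sum_neg_distrib, real_inner_self_eq_norm_sq] at h2
  have h4 := (Finset.sum_eq_zero_iff_of_nonneg (s := Finset.univ)
    (f := fun c => ‖v c‖ ^ 2) (fun c _ => sq_nonneg _)).mp
    (le_antisymm (by linarith) (Finset.sum_nonneg fun c _ => sq_nonneg _))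
  ext c
  simpa using h4 c (Finset.mem_univ c)

variable [CompleteSpace H] [RKHS ℝ H Y ℝ]

/-- The rows of `(D̂ + I)⁻¹ Ĝ`. -/
noncomputable def weight (a : A) : H := ∑ b, (DHat β p ℓ' S + 1)⁻¹ a b • GHat β p ℓ' S b

/-- Symmetry of D̂ moves the inverse from the rule onto Ĝ. -/
lemma patch_eq (R₂ : ℝ) (x : X) :
    patch β R₂ p ℓ' S x =
      projBall R₂ (p x + ∑ a, smoothRule β (lossEstimator p) ℓ' x a • weight β p ℓ' S a) := by
  have hsymm : ((DHat β p ℓ' S + 1)⁻¹).IsSymm :=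
    ((DHat_isSymm β p ℓ' S).add Matrix.isSymm_one).inv
  unfold patch weight
  congr 2
  simp only [Matrix.mulVec, dotProduct, Finset.sum_smul, Finset.smul_sum, smul_smul]
  rw [Finset.sum_comm]
  refine Finset.sum_congr rfl fun a _ => Finset.sum_congr rfl fun b _ => ?_
  rw [hsymm.apply a b, mul_comm]

lemma GHat_eq (a : A) :
    GHat β p ℓ' S a = weight β p ℓ' S a + ∑ b, DHat β p ℓ' S a b • weight β p ℓ' S b := by
  have hB := Matrix.mul_nonsing_inv (DHat β p ℓ' S + 1)
    ((Matrix.isUnit_iff_isUnit_det _).mp (isUnit_DHat_add_one β p ℓ' S))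
  have h : ∑ b, (DHat β p ℓ' S + 1) a b • weight β p ℓ' S b = GHat β p ℓ' S a := by
    simp only [weight, Finset.smul_sum, smul_smul]
    rw [Finset.sum_comm]
    simp only [← Finset.sum_smul, ← Matrix.mul_apply, hB]
    simp [Matrix.one_apply]
  rw [← h]
  simp [Matrix.add_apply, add_smul, Finset.sum_add_distrib, Matrix.one_apply, add_comm]

end Empirical

/-! ### Population squared error under a patch -/

section Population

variable {X Y A H : Type*} [MeasurableSpace X] [MeasurableSpace Y]
  [Fintype A] [Nonempty A] [NormedAddCommGroup H] [InnerProductSpace ℝ H] [CompleteSpace H]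
  [SecondCountableTopology H] [MeasurableSpace H] [BorelSpace H] [RKHS ℝ H Y ℝ]
  (D : Measure (X × Y)) [IsProbabilityMeasure D] {β R₁ R₂ ε : ℝ} {p : X → H}

omit [Nonempty A] [CompleteSpace H] in
lemma measurable_smoothRule_apply (hp : Measurable p) (ℓ : A → H) (a : A) :
    Measurable fun x => smoothRule β (lossEstimator p) ℓ x a :=
  (measurable_smoothRule (Ω := Unit) β (P := fun _ => p) (L := fun _ => ℓ)
    (hp.comp measurable_snd) measurable_const a).comp (measurable_prodMk_left (x := ()))

omit [Nonempty A] in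
lemma measurable_residual_apply (hφ : Measurable fun y : Y => feature H y) (hp : Measurable p)
    (ℓ : A → H) (a : A) : Measurable (residual (Y := Y) β p ℓ a) :=
  ((measurable_smoothRule_apply hp ℓ a).comp measurable_fst).smul
    ((hφ.comp measurable_snd).sub (hp.comp measurable_fst))

omit [MeasurableSpace X] [MeasurableSpace Y] [SecondCountableTopology H] [MeasurableSpace H]
  [BorelSpace H] in
lemma norm_residual_le (hφR : ∀ y : Y, ‖feature H y‖ ≤ R₂) (hpR : ∀ x, ‖p x‖ ≤ R₂)
    (ℓ : A → H) (a : A) (z : X × Y) : ‖residual β p ℓ a z‖ ≤ 2 * R₂ := by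
  have h := norm_sub_le (feature H z.2) (p z.1)
  have h0 := smoothRule_nonneg β (lossEstimator p) ℓ z.1 a
  have h1 := smoothRule_le_one β (lossEstimator p) ℓ z.1 a
  rw [residual, norm_smul, Real.norm_of_nonneg h0]
  refine (mul_le_of_le_one_left (norm_nonneg _) h1).trans ?_
  linarith [hφR z.2, hpR z.1]

lemma integrable_residual (hφ : Measurable fun y : Y => feature H y)
    (hφR : ∀ y : Y, ‖feature H y‖ ≤ R₂) (hp : Measurable p) (hpR : ∀ x, ‖p x‖ ≤ R₂)
    (ℓ : A → H) (a : A) : Integrable (residual β p ℓ a) D :=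
  integrable_of_norm_le (measurable_residual_apply hφ hp ℓ a) _ (norm_residual_le hφR hpR ℓ a)

omit [MeasurableSpace X] [MeasurableSpace Y] [Nonempty A] [SecondCountableTopology H]
  [MeasurableSpace H] [BorelSpace H] in
lemma inner_sum_smoothRule (ℓ' V : A → H) (z : X × Y) :
    inner ℝ (∑ a, smoothRule β (lossEstimator p) ℓ' z.1 a • V a) (feature H z.2 - p z.1) =
      ∑ a, inner ℝ (V a) (residual β p ℓ' a z) := by
  simp only [sum_inner, residual, real_inner_smul_left, real_inner_smul_right]

lemma gap_eq_sum_inner (hφ : Measurable fun y : Y => feature H y)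
    (hφR : ∀ y : Y, ‖feature H y‖ ≤ R₂) (hp : Measurable p) (hpR : ∀ x, ‖p x‖ ≤ R₂)
    (ℓ' V : A → H) :
    gap D β p V ℓ' = ∑ a, inner ℝ (V a) (∫ z, residual β p ℓ' a z ∂D) := by
  have hi := fun a => integrable_residual D hφ hφR hp hpR (β := β) ℓ' a
  simp only [gap, inner_sum_smoothRule]
  rw [integral_finsetSum _ fun a _ => (hi a).const_inner (V a)]
  exact Finset.sum_congr rfl fun a _ => integral_inner (hi a) (V a)

lemma integrable_norm_sub_feature_sq (hφ : Measurable fun y : Y => feature H y)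
    (hφR : ∀ y : Y, ‖feature H y‖ ≤ R₂) (hp : Measurable p) (hpR : ∀ x, ‖p x‖ ≤ R₂) :
    Integrable (fun z : X × Y => ‖p z.1 - feature H z.2‖ ^ 2) D := by
  refine integrable_of_norm_le ?_ ((2 * R₂) ^ 2) fun z => ?_
  · exact ((hp.comp measurable_fst).sub (hφ.comp measurable_snd)).norm.pow_const 2
  · rw [norm_pow, norm_norm]
    gcongr
    linarith [norm_sub_le (p z.1) (feature H z.2), hφR z.2, hpR z.1]

lemma sqError_le (hφ : Measurable fun y : Y => feature H y)
    (hφR : ∀ y : Y, ‖feature H y‖ ≤ R₂) (hp : Measurable p) (hpR : ∀ x, ‖p x‖ ≤ R₂) :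
    sqError D p ≤ 4 * R₂ ^ 2 := by
  refine (integral_mono (integrable_norm_sub_feature_sq D hφ hφR hp hpR)
    (integrable_const ((2 * R₂) ^ 2)) fun z => ?_).trans (by simp; linarith)
  dsimp only
  gcongr
  linarith [norm_sub_le (p z.1) (feature H z.2), hφR z.2, hpR z.1]

/-- The bound holds pointwise before integration: drop the projection, expand the square, and bound
the quadratic term by `norm_sum_smul_sq_le`. -/
lemma sqError_projBall_add_le (hφ : Measurable fun y : Y => feature H y)
    (hφR : ∀ y : Y, ‖feature H y‖ ≤ R₂) (hp : Measurable p) (hpR : ∀ x, ‖p x‖ ≤ R₂)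
    (ℓ' W : A → H) :
    sqError D (fun x => projBall R₂ (p x + ∑ a, smoothRule β (lossEstimator p) ℓ' x a • W a)) ≤
      sqError D p - 2 * ∑ a, inner ℝ (W a) (∫ z, residual β p ℓ' a z ∂D) + ∑ a, ‖W a‖ ^ 2 := by
  have hi := fun a => integrable_residual D hφ hφR hp hpR (β := β) ℓ' a
  have hR : 0 ≤ R₂ := by
    obtain ⟨z⟩ := D.nonempty_of_neZero
    exact (norm_nonneg _).trans (hpR z.1)
  have hsum : Measurable fun x => ∑ a, smoothRule β (lossEstimator p) ℓ' x a • W a :=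
    Finset.measurable_fun_sum _ fun a _ => (measurable_smoothRule_apply hp ℓ' a).smul_const _
  have hgap : Integrable (fun z : X × Y => inner ℝ
      (∑ a, smoothRule β (lossEstimator p) ℓ' z.1 a • W a) (feature H z.2 - p z.1)) D := by
    simp only [inner_sum_smoothRule]
    exact integrable_finsetSum _ fun a _ => (hi a).const_inner (W a)
  have hsq := integrable_norm_sub_feature_sq D hφ hφR hp hpR
  rw [← gap_eq_sum_inner D hφ hφR hp hpR ℓ' W, gap, sqError, sqError,
    ← integral_const_mul, ← integral_sub hsq (hgap.const_mul 2)]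
  have hleft := integrable_norm_sub_feature_sq D hφ hφR
    ((measurable_projBall R₂).comp (hp.add hsum)) fun x => norm_projBall_le hR _
  have hpt : ∀ z : X × Y, ‖projBall R₂ (p z.1 + ∑ a, smoothRule β (lossEstimator p) ℓ' z.1 a • W a)
      - feature H z.2‖ ^ 2 ≤ ‖p z.1 - feature H z.2‖ ^ 2 - 2 * inner ℝ
        (∑ a, smoothRule β (lossEstimator p) ℓ' z.1 a • W a) (feature H z.2 - p z.1) +
        ∑ a, ‖W a‖ ^ 2 := by
    intro z
    have h3 := norm_sum_smul_sq_le (fun a => smoothRule_nonneg β (lossEstimator p) ℓ' z.1 a)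
      (sum_smoothRule _ _ _ _) W
    generalize ∑ a, smoothRule β (lossEstimator p) ℓ' z.1 a • W a = v at h3 ⊢
    have h2 := pow_le_pow_left₀ (norm_nonneg _) (norm_projBall_sub_le (hφR z.2) (p z.1 + v)) 2
    have h4 : ‖p z.1 + v - feature H z.2‖ ^ 2 =
        ‖p z.1 - feature H z.2‖ ^ 2 - 2 * inner ℝ v (feature H z.2 - p z.1) + ‖v‖ ^ 2 := by
      rw [show p z.1 + v - feature H z.2 = (p z.1 - feature H z.2) + v by abel, norm_add_sq_real,
        real_inner_comm, ← neg_sub (feature H z.2) (p z.1), inner_neg_right]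
      ring
    linarith
  refine (integral_mono hleft ((hsq.sub (hgap.const_mul 2)).add
    (integrable_const (∑ a, ‖W a‖ ^ 2))) hpt).trans (le_of_eq ?_)
  rw [integral_add' (hsq.sub (hgap.const_mul 2)) (integrable_const _)]
  simp

/-- With s = ∑‖W_a‖, the violation bounds s from below, and the decrease is at least ∑‖W_a‖² − 2sη.
Cauchy–Schwarz over the actions joins the two and costs the factor |A|. -/
lemma sqError_patch_le [DecidableEq A] (hR₁ : 0 < R₁) (hε : 0 < ε)
    (hφ : Measurable fun y : Y => feature H y)
    (hφR : ∀ y : Y, ‖feature H y‖ ≤ R₂) (hp : Measurable p) (hpR : ∀ x, ‖p x‖ ≤ R₂)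
    {q : (A → H) × (A → H)} (hq : IsViolation D β R₁ ε p q) {n : ℕ} (S : Fin n → X × Y)
    (hS : ∀ a, ‖GHat β p q.2 S a - ∫ z, residual β p q.2 a z ∂D‖ ≤
      ε / (16 * R₁ * Fintype.card A)) :
    sqError D (patch β R₂ p q.2 S) ≤ sqError D p - ε ^ 2 / (8 * R₁ ^ 2 * Fintype.card A) := by
  obtain ⟨ℓ, ℓ'⟩ := q
  obtain ⟨hℓ, -, hgap⟩ := hq
  dsimp only at hℓ hgap hS ⊢
  have hA : (0 : ℝ) < Fintype.card A := by exact_mod_cast Fintype.card_pos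
  obtain ⟨N, hN⟩ : ∃ N : ℝ, N = Fintype.card A := ⟨_, rfl⟩
  rw [← hN] at hA hS ⊢
  set G := fun a => ∫ z, residual β p ℓ' a z ∂D with hG
  set W := weight β p ℓ' S with hW
  set k := smoothRule β (lossEstimator p) ℓ' with hk
  have hk0 : ∀ (z : X × Y) a, 0 ≤ k z.1 a := fun z => smoothRule_nonneg _ _ _ _
  have hk1 : ∀ z : X × Y, ∑ a, k z.1 a = 1 := fun z => sum_smoothRule _ _ _ _
  obtain ⟨s, hs⟩ : ∃ s : ℝ, s = ∑ a, ‖W a‖ := ⟨_, rfl⟩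
  have hs0 : 0 ≤ s := hs ▸ Finset.sum_nonneg fun a _ => norm_nonneg _
  set η := ε / (16 * R₁ * N) with hη
  -- the residual terms
  have herr : ∀ a, ‖G a - GHat β p ℓ' S a‖ ≤ η := fun a => by rw [norm_sub_rev]; exact hS a
  -- lower bound on the weights
  have hlow : ε ≤ R₁ * (N * η) + 2 * (R₁ * s) := by
    rw [gap_eq_sum_inner D hφ hφR hp hpR] at hgap
    have e1 : ∑ a, inner ℝ (ℓ a) (G a) = ∑ a, inner ℝ (ℓ a) (G a - GHat β p ℓ' S a) +
        (∑ a, inner ℝ (ℓ a) (W a) + ∑ a, inner ℝ (ℓ a) (∑ b, DHat β p ℓ' S a b • W b)) := by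
      rw [← Finset.sum_add_distrib, ← Finset.sum_add_distrib]
      refine Finset.sum_congr rfl fun a _ => ?_
      rw [← inner_add_right, ← inner_add_right, ← GHat_eq]
      simp
    have e2 : ∑ a, inner ℝ (ℓ a) (G a - GHat β p ℓ' S a) ≤ R₁ * (N * η) := by
      refine (Finset.sum_le_sum fun a _ => (real_inner_le_norm _ _).trans
        (mul_le_mul (hℓ a) (herr a) (norm_nonneg _) hR₁.le)).trans (le_of_eq ?_)
      simp [hN]; ring
    have e3 : ∑ a, inner ℝ (ℓ a) (W a) ≤ R₁ * s := by
      rw [hs, Finset.mul_sum]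
      exact Finset.sum_le_sum fun a _ => (real_inner_le_norm _ _).trans
        (mul_le_mul_of_nonneg_right (hℓ a) (norm_nonneg _))
    have e4 : ∑ a, inner ℝ (ℓ a) (∑ b, DHat β p ℓ' S a b • W b) ≤ R₁ * s := by
      rw [sum_inner_DHat]
      refine empMean_le S (by positivity) fun z => (real_inner_le_norm _ _).trans ?_
      exact mul_le_mul (norm_sum_smul_le_of_norm_le (hk0 z) (hk1 z) hℓ)
        (hs ▸ norm_sum_smul_le_sum_norm (hk0 z) (hk1 z) W) (norm_nonneg _) hR₁.le
    linarith
  -- the decrease in terms of the weights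
  have hdec : ∑ a, ‖W a‖ ^ 2 - s * η ≤ ∑ a, inner ℝ (W a) (G a) := by
    have e1 : ∑ a, inner ℝ (W a) (G a) = ∑ a, inner ℝ (W a) (G a - GHat β p ℓ' S a) +
        (∑ a, inner ℝ (W a) (W a) + ∑ a, inner ℝ (W a) (∑ b, DHat β p ℓ' S a b • W b)) := by
      rw [← Finset.sum_add_distrib, ← Finset.sum_add_distrib]
      refine Finset.sum_congr rfl fun a _ => ?_
      rw [← inner_add_right, ← inner_add_right, ← GHat_eq]
      simp
    have e2 : -(s * η) ≤ ∑ a, inner ℝ (W a) (G a - GHat β p ℓ' S a) := by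
      rw [hs, Finset.sum_mul, ← Finset.sum_neg_distrib]
      refine Finset.sum_le_sum fun a _ => ?_
      have := (abs_le.mp ((abs_real_inner_le_norm (W a) (G a - GHat β p ℓ' S a)).trans
        (mul_le_mul_of_nonneg_left (herr a) (norm_nonneg _)))).1
      linarith
    have e3 : 0 ≤ ∑ a, inner ℝ (W a) (∑ b, DHat β p ℓ' S a b • W b) := by
      rw [sum_inner_DHat]
      exact empMean_nonneg S fun z => real_inner_self_nonneg
    simp only [real_inner_self_eq_norm_sq] at e1
    linarith
  have hcs : s ^ 2 ≤ N * ∑ a, ‖W a‖ ^ 2 := by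
    rw [hs, hN]
    exact sq_sum_le_card_mul_sum_sq
  have hpot := sqError_projBall_add_le D hφ hφR hp hpR (β := β) ℓ' W
  rw [show patch β R₂ p ℓ' S = _ from funext (patch_eq β p ℓ' S R₂)]
  have hRη : R₁ * (N * η) = ε / 16 := by rw [hη]; field_simp
  -- The estimation error uses up ε/16 of the gap, so 2R₁s ≥ 15ε/16.
  have hsε : 15 * (ε / R₁) ≤ 32 * s := by
    rw [← mul_div_assoc, div_le_iff₀ hR₁]; linarith
  have hfin : ε ^ 2 / (8 * R₁ ^ 2 * N) ≤ ∑ a, ‖W a‖ ^ 2 - 2 * (s * η) := by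
    have e1 : s ^ 2 / N ≤ ∑ a, ‖W a‖ ^ 2 := by rw [div_le_iff₀ hA]; linarith
    refine le_trans ?_ (sub_le_sub_right e1 _)
    have e2 : s ^ 2 / N - 2 * (s * η) - ε ^ 2 / (8 * R₁ ^ 2 * N) =
        (s ^ 2 - s * (ε / R₁) / 8 - (ε / R₁) ^ 2 / 8) / N := by
      rw [hη]; field_simp; ring
    -- At s = (15/32)(ε/R₁) the value is (225 − 60 − 128)/1024 · (ε/R₁)² > 0, and the quadratic
    -- increases from there.
    have e3 : 0 ≤ s ^ 2 - s * (ε / R₁) / 8 - (ε / R₁) ^ 2 / 8 := by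
      have : 0 < ε / R₁ := by positivity
      nlinarith
    rw [← sub_nonneg, e2]
    positivity
  linarith

end Population

/-! ### What the test says when it succeeds and when it fails -/

section Guard

variable {X Y A H : Type*} [MeasurableSpace X] [MeasurableSpace Y]
  [Fintype A] [Nonempty A] [NormedAddCommGroup H] [InnerProductSpace ℝ H] [CompleteSpace H]
  [SecondCountableTopology H] [MeasurableSpace H] [BorelSpace H] [RKHS ℝ H Y ℝ]
  (D : Measure (X × Y)) [IsProbabilityMeasure D] {β R₁ R₂ ε : ℝ} {p : X → H}

omit [SecondCountableTopology H] [MeasurableSpace H] [BorelSpace H] in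
lemma gap_le (hφR : ∀ y : Y, ‖feature H y‖ ≤ R₂) (hpR : ∀ x, ‖p x‖ ≤ R₂) {ℓ : A → H}
    (hℓ : ℓ ∈ lossClass A H R₁) (ℓ' : A → H) : gap D β p ℓ ℓ' ≤ R₁ * (2 * R₂) := by
  have hR₁ : 0 ≤ R₁ := (norm_nonneg _).trans (hℓ (Classical.arbitrary A))
  refine (le_abs_self _).trans ?_
  have h := norm_integral_le_of_norm_le_const (μ := D) (C := R₁ * (2 * R₂))
    (f := fun z : X × Y => inner ℝ (∑ a, smoothRule β (lossEstimator p) ℓ' z.1 a • ℓ a)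
      (feature H z.2 - p z.1)) (Filter.Eventually.of_forall fun z => ?_)
  · simpa [gap] using h
  · refine (abs_real_inner_le_norm _ _).trans (mul_le_mul ?_ ?_ (norm_nonneg _) hR₁)
    · exact norm_sum_smul_le_of_norm_le (fun a => smoothRule_nonneg _ _ _ _ a)
        (sum_smoothRule _ _ _ _) hℓ
    · linarith [norm_sub_le (feature H z.2) (p z.1), hφR z.2, hpR z.1]

omit [SecondCountableTopology H] [MeasurableSpace H] [BorelSpace H] in
-- Supplies R₁R₂/ε > 1/2, the only lower bound on the scale available for the sample-size estimates.
lemma LoopGuard.lt (hφR : ∀ y : Y, ‖feature H y‖ ≤ R₂) (hpR : ∀ x, ‖p x‖ ≤ R₂)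
    (h : LoopGuard A D β R₁ ε p) : ε < R₁ * (2 * R₂) := by
  obtain ⟨q, hq, -, hlt⟩ := h
  exact hlt.trans_le (gap_le D hφR hpR hq q.2)

/-- The reproducing property ℓ_a(y) = ⟨ℓ_a, φ(y)⟩ puts both expectations in terms of inner products
with ℓ_a. -/
lemma integral_sub_integral_eq_gap (hφ : Measurable fun y : Y => feature H y)
    (hφR : ∀ y : Y, ‖feature H y‖ ≤ R₂) (hp : Measurable p) (hpR : ∀ x, ‖p x‖ ≤ R₂)
    (ℓ ℓ' : A → H) :
    (∫ z : X × Y, ∑ a, smoothRule β (lossEstimator p) ℓ' z.1 a * (ℓ a) z.2 ∂D) -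
      ∫ z : X × Y, ∑ a, smoothRule β (lossEstimator p) ℓ' z.1 a * lossEstimator p z.1 a ℓ ∂D =
      gap D β p ℓ ℓ' := by
  have hrep : ∀ (a : A) (y : Y), (ℓ a) y = inner ℝ (ℓ a) (feature H y) := fun a y => by
    simp [feature]
  have hint : ∀ v : X × Y → H, Measurable v → (∀ z, ‖v z‖ ≤ R₂) → Integrable (fun z : X × Y =>
      ∑ a, smoothRule β (lossEstimator p) ℓ' z.1 a * inner ℝ (ℓ a) (v z)) D := by
    intro v hv hvR
    refine integrable_finsetSum _ fun a _ => integrable_of_norm_le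
      (((measurable_smoothRule_apply hp ℓ' a).comp measurable_fst).mul (measurable_const.inner hv))
      (‖ℓ a‖ * R₂) fun z => ?_
    have h0 := smoothRule_nonneg β (lossEstimator p) ℓ' z.1 a
    have h1 := smoothRule_le_one β (lossEstimator p) ℓ' z.1 a
    change ‖smoothRule β (lossEstimator p) ℓ' z.1 a * inner ℝ (ℓ a) (v z)‖ ≤ _
    rw [norm_mul, Real.norm_of_nonneg h0]
    refine (mul_le_of_le_one_left (norm_nonneg _) h1).trans ?_
    exact (norm_inner_le_norm _ _).trans (mul_le_mul_of_nonneg_left (hvR z) (norm_nonneg _))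
  simp only [hrep, lossEstimator]
  rw [← integral_sub (hint (fun z => feature H z.2) (hφ.comp measurable_snd) fun z => hφR z.2)
    (hint (fun z => p z.1) (hp.comp measurable_fst) fun z => hpR z.1)]
  refine integral_congr_ae (Filter.Eventually.of_forall fun z => ?_)
  simp only [sum_inner, inner_sub_right, real_inner_smul_left]

/-- The test is one-sided, but the loss class is closed under negation and the gap is odd in ℓ, so
it controls the absolute value. -/
lemma isDecCalibrated_of_not_loopGuard (hφ : Measurable fun y : Y => feature H y)
    (hφR : ∀ y : Y, ‖feature H y‖ ≤ R₂) (hp : Measurable p) (hpR : ∀ x, ‖p x‖ ≤ R₂)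
    (h : ¬ LoopGuard A D β R₁ ε p) :
    IsDecCalibrated D (lossClass A H R₁) (smoothRules β (lossEstimator p) (lossClass A H R₁)) ε
      (lossEstimator p) := by
  have hle : ∀ ℓ ∈ lossClass A H R₁, ∀ ℓ' ∈ lossClass A H R₁, gap D β p ℓ ℓ' ≤ ε := by
    intro ℓ hℓ ℓ' hℓ'
    by_contra hlt
    exact h ⟨(ℓ, ℓ'), hℓ, hℓ', not_le.mp hlt⟩
  refine iSup₂_le fun ℓ hℓ => iSup₂_le ?_
  rintro k ⟨ℓ', hℓ', rfl⟩
  refine ENNReal.ofReal_le_ofReal ?_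
  rw [integral_sub_integral_eq_gap D hφ hφR hp hpR, abs_le]
  refine ⟨?_, hle ℓ hℓ ℓ' hℓ'⟩
  have hneg := hle (-ℓ) (fun a => by simpa using hℓ a) ℓ' hℓ'
  have : gap D β p (-ℓ) ℓ' = -gap D β p ℓ ℓ' := by
    simp only [gap, Pi.neg_apply, smul_neg, Finset.sum_neg_distrib, inner_neg_left, integral_neg]
  linarith

end Guard

/-! ### The run of the algorithm on all batches -/

section Run

variable {X Y A H : Type*} [MeasurableSpace X] [MeasurableSpace Y]
  [Fintype A] [DecidableEq A] [NormedAddCommGroup H] [InnerProductSpace ℝ H]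
  [CompleteSpace H] [SecondCountableTopology H] [MeasurableSpace H] [BorelSpace H] [RKHS ℝ H Y ℝ]
  (D : Measure (X × Y)) [IsProbabilityMeasure D] {β R₁ R₂ ε : ℝ} {p₀ : X → H}

/-- The error `Ĝₐ - Gₐ` of round `t` as a function of all batches. -/
noncomputable def roundError (β R₂ : ℝ) (p₀ : X → H) {T n : ℕ} (sel : Selector X Y A H n)
    (t : Fin T) (a : A) (ω : Fin T → Fin n → X × Y) : H :=
  GHat β (predictorAt β R₂ p₀ sel t (Fin.take t t.2.le ω)) (sel t (Fin.take t t.2.le ω)).2 (ω t) a -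
    ∫ z, residual β (predictorAt β R₂ p₀ sel t (Fin.take t t.2.le ω))
      (sel t (Fin.take t t.2.le ω)).2 a z ∂D

lemma measurable_roundError (hφ : Measurable fun y : Y => feature H y) (hp₀ : Measurable p₀)
    {T n : ℕ} {sel : Selector X Y A H n} (hsel : ∀ t, Measurable (sel t)) (t : Fin T) (a : A) :
    Measurable (roundError D β R₂ p₀ sel t a) := by
  have htake : Measurable fun ω : Fin T → Fin n → X × Y => Fin.take (t : ℕ) t.2.le ω :=
    measurable_pi_lambda _ fun i => measurable_pi_apply _
  have hP : Measurable (Function.uncurry fun ω : Fin T → Fin n → X × Y =>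
      predictorAt β R₂ p₀ sel t (Fin.take t t.2.le ω)) :=
    (measurable_predictorAt hφ β R₂ hp₀ hsel t).comp
      ((htake.comp measurable_fst).prodMk measurable_snd)
  have hL : Measurable fun ω : Fin T → Fin n → X × Y => (sel t (Fin.take t t.2.le ω)).2 :=
    measurable_snd.comp ((hsel t).comp htake)
  refine (measurable_GHat hφ β hP hL (measurable_pi_apply t) a).sub ?_
  exact (StronglyMeasurable.integral_prod_right
    (measurable_residual hφ β hP hL a).stronglyMeasurable).measurable

/-- The predictor and the losses of round t do not depend on batch t. With the other batches frozen,
Ĝ_a is a mean of i.i.d. vectors of norm at most 2R₂. This holds whether or not the loop has already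
ended. -/
lemma measure_roundError_ge_le [Nonempty A] (hR₂ : 0 < R₂)
    (hφ : Measurable fun y : Y => feature H y)
    (hφR : ∀ y : Y, ‖feature H y‖ ≤ R₂) (hp₀ : Measurable p₀) (hp₀R : ∀ x, ‖p₀ x‖ ≤ R₂)
    {T n : ℕ} (hn : 0 < n) {sel : Selector X Y A H n} (hsel : ∀ t, Measurable (sel t))
    (t : Fin T) (a : A) {η : ℝ} (hη : 0 < η) :
    (Measure.pi fun _ : Fin T => Measure.pi fun _ : Fin n => D)
        {ω | η ≤ ‖roundError D β R₂ p₀ sel t a ω‖} ≤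
      ENNReal.ofReal (2 * Real.exp (-(n * η ^ 2 / (8 * (2 * R₂) ^ 2)))) := by
  refine measure_pi_le_of_update_le _ t
    (measurableSet_le measurable_const (measurable_roundError D hφ hp₀ hsel t a).norm) _ fun ω => ?_
  have hupd : ∀ S, Fin.take (t : ℕ) t.2.le (Function.update ω t S) = Fin.take t t.2.le ω :=
    fun S => Fin.take_update_of_ge _ _ _ _ le_rfl _
  have hp := measurable_predictorAt_apply hφ β R₂ hp₀ hsel t (Fin.take (t : ℕ) t.2.le ω)
  have hpR := norm_predictorAt_le β hR₂.le hp₀R sel t (Fin.take (t : ℕ) t.2.le ω)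
  have h := measure_empMean_sub_ge_le D
    (measurable_residual_apply (β := β) hφ hp (sel t (Fin.take (t : ℕ) t.2.le ω)).2 a)
    (c := 2 * R₂) (by positivity) (norm_residual_le hφR hpR _ a) hn hη
  refine (measure_mono fun S hS => ?_).trans h
  simp only [Set.mem_ofPred_eq, roundError, hupd, Function.update_self] at hS
  exact hS

lemma sqError_predictorAt_le [Nonempty A] (hR₁ : 0 < R₁) (hR₂ : 0 < R₂) (hε : 0 < ε)
    (hφ : Measurable fun y : Y => feature H y)
    (hφR : ∀ y : Y, ‖feature H y‖ ≤ R₂) (hp₀ : Measurable p₀) (hp₀R : ∀ x, ‖p₀ x‖ ≤ R₂)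
    {T n : ℕ} {sel : Selector X Y A H n} (hsel : ∀ t, Measurable (sel t))
    (hadm : IsAdmissible D β R₁ R₂ ε p₀ sel) (ω : Fin T → Fin n → X × Y)
    (hω : ∀ t a, ‖roundError D β R₂ p₀ sel t a ω‖ ≤ ε / (16 * R₁ * Fintype.card A))
    (t : ℕ) (ht : t ≤ T)
    (hguard : ∀ (s : ℕ) (hs : s < t),
      LoopGuard A D β R₁ ε (predictorAt β R₂ p₀ sel s (Fin.take s (hs.le.trans ht) ω))) :
    sqError D (predictorAt β R₂ p₀ sel t (Fin.take t ht ω)) ≤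
      sqError D p₀ - t * (ε ^ 2 / (8 * R₁ ^ 2 * Fintype.card A)) := by
  induction t with
  | zero => simp [predictorAt]
  | succ t ih =>
    have hle := ih (t.le_succ.trans ht) fun s hs => hguard s (hs.trans t.lt_succ_self)
    have hp := measurable_predictorAt_apply hφ β R₂ hp₀ hsel t (Fin.take t (t.le_succ.trans ht) ω)
    have hpR := norm_predictorAt_le β hR₂.le hp₀R sel t (Fin.take t (t.le_succ.trans ht) ω)
    -- Definitional unfolding: the first t + 1 batches are the first t followed by `ω ⟨t, ht⟩`.
    have hstep : sqError D (predictorAt β R₂ p₀ sel (t + 1) (Fin.take (t + 1) ht ω)) ≤ _ :=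
      sqError_patch_le D hR₁ hε hφ hφR hp hpR
        (hadm t _ (hguard t t.lt_succ_self)) (ω ⟨t, ht⟩) (hω ⟨t, ht⟩)
    push_cast
    linarith [hstep.trans (sub_le_sub_right hle _)]

end Run

/-! ### Sample size -/

/-- The batch size makes the union bound over rounds and actions work. Here `v = R₁ R₂ / ε`. -/
lemma union_bound_le {m v δ : ℝ} (hm : 1 ≤ m) (hv : 1 / 2 < v) (hδ : 0 < δ) (hδ1 : δ < 1)
    {T N n : ℕ} (hT : T = ⌊64 * (m * v ^ 2)⌋₊)
    (hN : 2 * 10 ^ 7 * (m * v) ^ 6 * Real.log (2 + m * v / δ) ≤ N) (hn : n = N / T) :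
    0 < n ∧ T * (m * (2 * Real.exp (-(n / (8192 * (m * v) ^ 2))))) ≤ δ := by
  have hm0 : 0 < m := by linarith
  have hv0 : 0 < v := by linarith
  obtain ⟨u, hu⟩ : ∃ u, u = m * v := ⟨_, rfl⟩
  rw [← hu] at hN ⊢
  have hu0 : 1 / 2 < u := by rw [hu]; nlinarith
  have hu2 : 1 / 4 ≤ u ^ 2 := by nlinarith
  have hmv : m * v ^ 2 ≤ u ^ 2 := by 
    rw [hu, mul_pow]
    have : m ≤ m ^ 2 := by nlinarith
    gcongr
  obtain ⟨w, hw⟩ : ∃ w, w = 2 + u / δ := ⟨_, rfl⟩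
  rw [← hw] at hN
  have hw2 : 2 ≤ w := by rw [hw]; have : 0 < u / δ := by positivity
                         linarith
  obtain ⟨L, hL⟩ : ∃ L, L = Real.log w := ⟨_, rfl⟩
  rw [← hL] at hN
  have hL0 : 1 / 2 ≤ L := by
    have := Real.log_le_log two_pos hw2
    linarith [Real.log_two_gt_d9]
  have hTle : (T : ℝ) ≤ 64 * (m * v ^ 2) := hT ▸ Nat.floor_le (by positivity)
  have hTpos : 0 < T := by
    rw [hT, Nat.floor_pos]
    nlinarith
  -- Natural division loses less than one sample per round.
  have hNn : (N : ℝ) ≤ T * (n + 1) := by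
    have := (Nat.lt_mul_div_succ N hTpos).le
    rw [← hn] at this
    exact_mod_cast this
  have h1 : 2 * 10 ^ 7 * u ^ 6 * L ≤ 64 * u ^ 2 * (n + 1) := by
    refine hN.trans (hNn.trans ?_)
    gcongr
    linarith
  have h2 : 78125 * (u ^ 2 * L) ≤ n + 1 := by
    -- A batch of order u²L is enough; the surplus factor u² is discarded using u² ≥ 1/4.
    have hu4 : u ^ 2 * (1 / 4) ≤ u ^ 4 := by nlinarith
    have h3 : u ^ 2 * (2 * 10 ^ 7 * u ^ 4 * L) ≤ u ^ 2 * (64 * (n + 1)) := by linarith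
    have h4 := le_of_mul_le_mul_left h3 (by positivity)
    have h5 : u ^ 2 * (1 / 4) * L ≤ u ^ 4 * L := by gcongr
    linarith
  have h3 : 1 ≤ 8 * (u ^ 2 * L) := by nlinarith
  -- 73728 = 9 · 8192. Of the resulting w⁻⁹, two powers absorb u²/δ and seven absorb the constant 2
  -- · 64 = 2⁷.
  have h4 : 73728 * (u ^ 2 * L) ≤ n := by linarith
  refine ⟨?_, ?_⟩
  · have : (0 : ℝ) < n := by linarith
    exact_mod_cast this
  have h5 : 9 * L ≤ n / (8192 * u ^ 2) := by
    rw [le_div_iff₀ (by positivity)]; linarith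
  have h6 : Real.exp (-(n / (8192 * u ^ 2))) ≤ (w ^ 9)⁻¹ := by
    have : w ^ 9 = Real.exp (9 * L) := by
      rw [hL, mul_comm, Real.exp_mul, Real.exp_log (by linarith)]
      norm_cast
    rw [this, ← Real.exp_neg]
    exact Real.exp_le_exp.mpr (by linarith)
  have h7 : T * m ≤ 64 * u ^ 2 := by
    calc T * m ≤ 64 * (m * v ^ 2) * m := by gcongr
      _ = 64 * u ^ 2 := by rw [hu]; ring
  have h8 : u ≤ δ * w := by rw [hw, mul_add, mul_div_cancel₀ _ hδ.ne']; linarith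
  have h9 : u ^ 2 ≤ δ * w ^ 2 := by
    calc u ^ 2 ≤ (δ * w) ^ 2 := by gcongr
      _ = δ * (δ * w ^ 2) := by ring
      _ ≤ 1 * (δ * w ^ 2) := by gcongr
      _ = _ := one_mul _
  have h10 : (2 : ℝ) ^ 7 ≤ w ^ 7 := by gcongr
  calc T * (m * (2 * Real.exp (-(n / (8192 * u ^ 2)))))
      = 2 * (T * m) * Real.exp (-(n / (8192 * u ^ 2))) := by ring
    _ ≤ 2 * (64 * u ^ 2) * (w ^ 9)⁻¹ := by gcongr
    _ ≤ δ := by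
      rw [← div_eq_mul_inv, div_le_iff₀ (by positivity)]
      calc 2 * (64 * u ^ 2) ≤ 2 ^ 7 * (δ * w ^ 2) := by linarith
        _ ≤ w ^ 7 * (δ * w ^ 2) := by gcongr
        _ = δ * w ^ 9 := by ring

end DecCal

theorem mainTheorem5 :
    ∃ C₁ C₂ : ℝ, 0 < C₁ ∧ 0 < C₂ ∧
    ∀ (X Y A H : Type*) [MeasurableSpace X] [MeasurableSpace Y]
      [Fintype A] [DecidableEq A] [Nonempty A]
      [NormedAddCommGroup H] [InnerProductSpace ℝ H] [CompleteSpace H]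
      [TopologicalSpace.SeparableSpace H] [MeasurableSpace H] [BorelSpace H] [RKHS ℝ H Y ℝ]
      (D : Measure (X × Y)) [IsProbabilityMeasure D]
      (β R₁ R₂ ε δ : ℝ) (p₀ : X → H),
      0 < β → 0 < R₁ → 0 < R₂ → 0 < ε → 0 < δ → δ < 1 →
      Measurable (fun y : Y => DecCal.feature H y) →
      (∀ y : Y, ‖DecCal.feature H y‖ ≤ R₂) →
      Measurable p₀ → (∀ x, ‖p₀ x‖ ≤ R₂) →
      ∀ T N n : ℕ,
        T = ⌊C₁ * (Fintype.card A * R₁ ^ 2 * R₂ ^ 2 / ε ^ 2)⌋₊ →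
        C₂ * ((Fintype.card A : ℝ) ^ 6 * R₁ ^ 6 * R₂ ^ 6 / ε ^ 6) *
          Real.log (2 + Fintype.card A * R₁ * R₂ / (ε * δ)) ≤ N →
        n = N / T →
        ∀ sel : DecCal.Selector X Y A H n,
          (∀ t, Measurable (sel t)) →
          DecCal.IsAdmissible D β R₁ R₂ ε p₀ sel →
          (Measure.pi fun _ : Fin T => Measure.pi fun _ : Fin n => D)
            {ω | ¬ ∃ (t : ℕ) (ht : t ≤ T),
              DecCal.EndsAt D β R₁ R₂ ε p₀ sel t (Fin.take t ht ω) ∧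
              DecCal.IsDecCalibrated D (DecCal.lossClass A H R₁)
                (DecCal.smoothRules β
                  (DecCal.lossEstimator (DecCal.predictorAt β R₂ p₀ sel t (Fin.take t ht ω)))
                  (DecCal.lossClass A H R₁)) ε
                (DecCal.lossEstimator (DecCal.predictorAt β R₂ p₀ sel t (Fin.take t ht ω))) ∧
              DecCal.sqError D (DecCal.predictorAt β R₂ p₀ sel t (Fin.take t ht ω)) ≤
                DecCal.sqError D p₀ ∧
              (DecCal.IsKernelExpansion p₀ →
                DecCal.IsKernelExpansion
                  (DecCal.predictorAt β R₂ p₀ sel t (Fin.take t ht ω)))} ≤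
            ENNReal.ofReal δ := by
  refine ⟨64, 2 * 10 ^ 7, by norm_num, by norm_num, ?_⟩
  intro X Y A H _ _ _ _ _ _ _ _ _ _ _ _ D _ β R₁ R₂ ε δ p₀ _ hR₁ hR₂ hε hδ hδ1 hφ hφR hp₀ hp₀R
    T N n hT hN hn sel hsel hadm
  have : SecondCountableTopology H := UniformSpace.secondCountable_of_separable H
  -- it is enough to end at some time with no more error than at the start
  have hconcl : ∀ (ω : Fin T → Fin n → X × Y) (t : ℕ) (ht : t ≤ T),
      DecCal.EndsAt D β R₁ R₂ ε p₀ sel t (Fin.take t ht ω) →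
      DecCal.sqError D (DecCal.predictorAt β R₂ p₀ sel t (Fin.take t ht ω)) ≤
        DecCal.sqError D p₀ →
      ∃ (t : ℕ) (ht : t ≤ T),
        DecCal.EndsAt D β R₁ R₂ ε p₀ sel t (Fin.take t ht ω) ∧
        DecCal.IsDecCalibrated D (DecCal.lossClass A H R₁)
          (DecCal.smoothRules β
            (DecCal.lossEstimator (DecCal.predictorAt β R₂ p₀ sel t (Fin.take t ht ω)))
            (DecCal.lossClass A H R₁)) ε
          (DecCal.lossEstimator (DecCal.predictorAt β R₂ p₀ sel t (Fin.take t ht ω))) ∧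
        DecCal.sqError D (DecCal.predictorAt β R₂ p₀ sel t (Fin.take t ht ω)) ≤
          DecCal.sqError D p₀ ∧
        (DecCal.IsKernelExpansion p₀ →
          DecCal.IsKernelExpansion (DecCal.predictorAt β R₂ p₀ sel t (Fin.take t ht ω))) :=
    fun ω t ht hend hsq =>
      ⟨t, ht, hend, DecCal.isDecCalibrated_of_not_loopGuard D hφ hφR
        (DecCal.measurable_predictorAt_apply hφ β R₂ hp₀ hsel t _)
        (DecCal.norm_predictorAt_le β hR₂.le hp₀R sel t _) hend.2, hsq,
        fun hexp => hexp.predictorAt β R₂ sel t _⟩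
  -- If p₀ passes the test, the loop ends at round 0 on every sample. This covers T = 0, where n = N
  -- / 0 = 0; in the other case v > 1/2 makes T positive.
  by_cases hg₀ : DecCal.LoopGuard A D β R₁ ε p₀
  swap
  · refine le_of_eq_of_le ?_ zero_le
    refine (congrArg _ (Set.eq_empty_iff_forall_notMem.mpr fun ω hω => ?_)).trans measure_empty
    exact hω (hconcl ω 0 T.zero_le ⟨fun s hs => absurd hs (Nat.not_lt_zero s), hg₀⟩ le_rfl)
  have hlt := hg₀.lt D hφR hp₀R
  obtain ⟨m, hm⟩ : ∃ m : ℝ, m = Fintype.card A := ⟨_, rfl⟩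
  have hm1 : 1 ≤ m := by rw [hm]; exact_mod_cast Fintype.card_pos
  obtain ⟨v, hv⟩ : ∃ v : ℝ, v = R₁ * R₂ / ε := ⟨_, rfl⟩
  have hv2 : 1 / 2 < v := by rw [hv, lt_div_iff₀ hε]; linarith
  have hT' : T = ⌊64 * (m * v ^ 2)⌋₊ := by
    rw [hT, hm, hv]; congr 2; field_simp
  have hN' : 2 * 10 ^ 7 * (m * v) ^ 6 * Real.log (2 + m * v / δ) ≤ N := by
    refine le_of_eq_of_le ?_ hN
    rw [← hm, hv]
    congr 1
    · field_simp
    · congr 2; field_simp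
  obtain ⟨hn0, hub⟩ := DecCal.union_bound_le hm1 hv2 hδ hδ1 hT' hN' hn
  set η := ε / (16 * R₁ * Fintype.card A) with hη
  have hη0 : 0 < η := by rw [hη, ← hm]; positivity
  set B : Fin T → A → Set (Fin T → Fin n → X × Y) :=
    fun t a => {ω | η ≤ ‖DecCal.roundError D β R₂ p₀ sel t a ω‖} with hB
  have hB_le : ∀ t a, (Measure.pi fun _ : Fin T => Measure.pi fun _ : Fin n => D) (B t a) ≤
      ENNReal.ofReal (2 * Real.exp (-(n / (8192 * (m * v) ^ 2)))) := by
    intro t a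
    refine (DecCal.measure_roundError_ge_le D hR₂ hφ hφR hp₀ hp₀R hn0 hsel t a hη0).trans
      (le_of_eq ?_)
    congr 4
    -- 8192 = 8 · 2² · 16².
    rw [hη, ← hm, hv]; field_simp; norm_num
  have hunion : (Measure.pi fun _ : Fin T => Measure.pi fun _ : Fin n => D)
      (⋃ t, ⋃ a, B t a) ≤ ENNReal.ofReal δ := by
    refine (measure_iUnion_fintype_le _ _).trans ?_
    refine (Finset.sum_le_sum fun t _ => (measure_iUnion_fintype_le _ _).trans
      (Finset.sum_le_sum fun a _ => hB_le t a)).trans ?_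
    refine le_trans (le_of_eq ?_) (ENNReal.ofReal_le_ofReal hub)
    simp only [Finset.sum_const, Finset.card_univ, Fintype.card_fin, nsmul_eq_mul]
    rw [ENNReal.ofReal_mul (p := (T : ℝ)) (by positivity),
      ENNReal.ofReal_mul (p := m) (by positivity), ENNReal.ofReal_natCast, hm,
      ENNReal.ofReal_natCast]
  -- The failure event need not be measurable: it is covered by the measurable events on which some
  -- Ĝ_a is inaccurate.
  refine (measure_mono fun ω hω => ?_).trans hunion
  by_contra hgood
  refine hω ?_
  have hround : ∀ t a, ‖DecCal.roundError D β R₂ p₀ sel t a ω‖ ≤ η := by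
    intro t a
    by_contra hta
    exact hgood (Set.mem_iUnion₂.mpr ⟨t, a, (not_le.mp hta).le⟩)
  have hdec := DecCal.sqError_predictorAt_le D hR₁ hR₂ hε hφ hφR hp₀ hp₀R hsel hadm ω hround
  have hexit : ∃ t, ∃ ht : t ≤ T,
      ¬ DecCal.LoopGuard A D β R₁ ε (DecCal.predictorAt β R₂ p₀ sel t (Fin.take t ht ω)) := by
    by_contra! hall
    have hend := hdec T le_rfl fun s hs => hall s hs.le
    have h0 : 0 ≤ DecCal.sqError D (DecCal.predictorAt β R₂ p₀ sel T (Fin.take T le_rfl ω)) :=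
      integral_nonneg fun z => sq_nonneg _
    have h4 := DecCal.sqError_le D hφ hφR hp₀ hp₀R
    have hTlt : 64 * (m * v ^ 2) < T + 1 := hT' ▸ Nat.lt_floor_add_one _
    -- T full rounds would consume at most the initial potential 4R₂². With T + 1 > 64mv² this gives
    -- 32mv² < 1, contradicting mv² > 1/4.
    have hTv : (T : ℝ) ≤ 32 * (m * v ^ 2) := by
      have h5 : (T : ℝ) * (ε ^ 2 / (8 * R₁ ^ 2 * m)) ≤ 4 * R₂ ^ 2 := by rw [hm]; linarith
      rw [← mul_div_assoc, div_le_iff₀ (by positivity)] at h5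
      rw [hv, div_pow, ← mul_div_assoc, ← mul_div_assoc, le_div_iff₀ (by positivity)]
      linarith
    nlinarith
  classical
  obtain ⟨ht, hnot⟩ := Nat.find_spec hexit
  have hmin : ∀ (s : ℕ) (hs : s < Nat.find hexit), DecCal.LoopGuard A D β R₁ ε
      (DecCal.predictorAt β R₂ p₀ sel s (Fin.take s (hs.le.trans ht) ω)) := by
    intro s hs
    by_contra hs'
    exact Nat.find_min hexit hs ⟨hs.le.trans ht, hs'⟩
  refine hconcl ω _ ht ⟨hmin, hnot⟩ ((hdec _ ht hmin).trans (sub_le_self _ (by positivity)))
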